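/- **Setting.** Let $SE(3)=\mathbb R^3\rtimes SO(3)$ with product $(x_1,R_1)(x_2,R_2)=(x_1+R_1x_2,R_1R_2)$. Let $A_1,A_2,A_3$ (infinitesimal translations along the $x,y,z$ axes) and $A_4,A_5,A_6$ (infinitesimal rotations about these axes) be the basis of $T_e(SE(3))$, $[A_i,A_j]=\sum_k c^k_{ij}A_k$, $\mathcal A_i$ the left-invariant vector field with $\mathcal A_i|_e=A_i$, and $\omega^1,\dots,\omega^6$ the dual coframe. For a curve $\gamma$ put $\dot\gamma^i=\langle\omega^i|_\gamma,\dot\gamma\rangle$. The curve is horizontal if $\dot\gamma^1=\dot\gamma^2=\dot\gamma^6=0$, i.e. $\dot\gamma\in\Delta=\mathrm{span}\{\mathcal A_3,\mathcal A_4,\mathcal A_5\}$. For vector fields $V=\sum_k a^k\mathcal A_k$ along $\gamma$ the Cartan connection on $T(SE(3))$ is $$\nabla_{\dot\gamma}V=\sum_{k=1}^6\Big(\dot a^k+\sum_{i,j=1}^6c^k_{ij}\dot\gamma^ia^j\Big)\mathcal A_k .$$ For horizontal $\gamma$ and sections $V=\sum_{k\in\{3,4,5\}}a^k\mathcal A_k$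 of $\Delta$ along $\gamma$ put $$\bar\nabla_{\dot\gamma}V=\sum_{k\in\{3,4,5\}}\Big(\dot a^k+\sum_{i,j\in\{3,4,5\}}c^k_{ij}\dot\gamma^ia^j\Big)\mathcal A_k ,$$ and for covector fields $\lambda=\sum_{k=1}^6\lambda_k\omega^k$ along $\gamma$ (the dual of the connection with the connection form $\sum_{i\in\{3,4,5\}}\omega^i\otimes\mathrm{ad}(\mathcal A_i)$ on all of $T(SE(3))$) $$\bar\nabla_{\dot\gamma}\lambda=\sum_{j=1}^6\Big(\dot\lambda_j-\sum_{i\in\{3,4,5\}}\sum_{k=1}^6c^k_{ij}\dot\gamma^i\lambda_k\Big)\omega^j .$$ An exponential curve is a curve $\gamma(s)=\gamma(0)\,\mathrm{Exp}\big(s\sum_{i=1}^6c^iA_i\big)$ with constants $c^i$. **Theorem.** Let $I\subseteq\mathbb R$ be an interval with more than one point, $0\in I$, and $\gamma:I\to SE(3)$ a curve. 1. $\gamma$ is an autoparallel curve of $\nabla$ (i.e. $\gamma$ is $C^2$ and $\nabla_{\dot\gamma}\dot\gamma=0$) if and only if it is an exponential curve. It is moreover parametrized by spatial arc length if and only if it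 is an exponential curve with $(c^1)^2+(c^2)^2+(c^3)^2=1$; and it has in addition $\dot\gamma^6=0$ if and only if it is such an exponential curve with $c^6=0$. 2. $\gamma$ is an autoparallel curve of $\bar\nabla$ (i.e. $\gamma$ is $C^2$ and horizontal and $\bar\nabla_{\dot\gamma}\dot\gamma=0$) if and only if it is a horizontal exponential curve, equivalently an exponential curve with $c^1=c^2=c^6=0$. It is moreover parametrized by spatial arc length if and only if also $(c^3)^2=1$. 3. Thus along an exponential curve the tangent vectors are covariantly constant. Along stationary curves the momentum is covariantly constant, $\bar\nabla_{\dot\gamma}\lambda=0$, in both of the following senses, for every $\beta>0$. (a) Let $r\mapsto\Gamma(r)=(\gamma,\kappa_1,\kappa_2,\sigma,\lambda_1,\dots,\lambda_6)(r)$, $r\in[0,\ell]$, $\gamma(r)\in SE(3)$, $\kappa_1,\kappa_2,\lambda_i\in\mathbb R$, $\sigma>0$, be a $C^2$ curve which is stationary, under all $C^2$ perturbations that keep $\gamma(0)$ and $\gamma(\ell)$ fixed, for $\int\psi$, where $$\psi=\sqrt{\kappa_1^2+\kappa_2^2+\beta^2}\,ds+\lambda_1\omega^1+\lambda_2\omega^2+\lambda_3(\omega^3-ds)+\lambda_4(\omega^4+\kappa_2ds)+\lambda_5(\omega^5-\kappa_1ds)+\lambda_6\omega^6,\qquad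 ds=\sigma\,dr .$$ Then $\gamma$ is horizontal and $\bar\nabla_{\dot\gamma}\lambda=0$ on $[0,\ell]$ for $\lambda=\sum_{i=1}^6\lambda_i\omega^i|_\gamma$. (b) Let $x:[0,L]\to\mathbb R^3$ be a $C^4$ curve parametrized by arc length which is a stationary curve of $\mathcal E(x)=\int\sqrt{\kappa^2+\beta^2}\,ds$ ($\kappa$ the curvature, $s$ the arc length): the first variation of $\mathcal E$ at $x$ vanishes for all smooth perturbations supported in $(0,L)$. Let $\gamma=(x,R)$ be a $C^3$ horizontal lift of $x$ with $\dot\gamma^3=1$, and put $\kappa_1=\dot\gamma^5$, $\kappa_2=-\dot\gamma^4$, $w_i=\kappa_i/\sqrt{\kappa_1^2+\kappa_2^2+\beta^2}$. Then $\bar\nabla_{\dot\gamma}\lambda=0$ on $[0,L]$ for the momentum $\lambda=\sum_{i=1}^6\lambda_i\omega^i|_\gamma$ with $$(\lambda_1,\dots,\lambda_6)=\big(-\dot w_1,\,-\dot w_2,\,\beta\sqrt{1-w_1^2-w_2^2},\,-w_2,\,w_1,\,0\big).$$ -/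

import Mathlib

open scoped Matrix ContDiff

/-! ### The group `SE(3) = ℝ³ ⋊ SO(3)` -/

/-- A rigid motion `(x, R)` with `x ∈ ℝ³` and `R ∈ SO(3)`. -/
@[ext] structure SE3 where
  x : Fin 3 → ℝ
  R : Matrix (Fin 3) (Fin 3) ℝ
  orth : Rᵀ * R = 1
  det_eq : R.det = 1

/-- `4 × 4` real matrices in block form, the ambient space of `SE(3)`. -/
abbrev Mat4 := Matrix (Fin 3 ⊕ Fin 1) (Fin 3 ⊕ Fin 1) ℝ

namespace SE3

theorem orth' (g : SE3) : g.R * g.Rᵀ = 1 := mul_eq_one_comm.mp g.orth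

/-- The group product `(x₁, R₁) (x₂, R₂) = (x₁ + R₁ x₂, R₁ R₂)`. -/
instance : Mul SE3 where
  mul g h :=
    { x := g.x + g.R *ᵥ h.x
      R := g.R * h.R
      orth := by
        rw [Matrix.transpose_mul, Matrix.mul_assoc, ← Matrix.mul_assoc g.Rᵀ, g.orth,
          Matrix.one_mul, h.orth]
      det_eq := by rw [Matrix.det_mul, g.det_eq, h.det_eq, one_mul] }

instance : One SE3 where
  one := { x := 0, R := 1, orth := by simp, det_eq := by simp }

instance : Inv SE3 where
  inv g :=
    { x := -(g.Rᵀ *ᵥ g.x)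
      R := g.Rᵀ
      orth := by rw [Matrix.transpose_transpose, g.orth']
      det_eq := by rw [Matrix.det_transpose, g.det_eq] }

theorem mul_x (g h : SE3) : (g * h).x = g.x + g.R *ᵥ h.x := rfl
theorem mul_R (g h : SE3) : (g * h).R = g.R * h.R := rfl
theorem one_x : (1 : SE3).x = 0 := rfl
theorem one_R : (1 : SE3).R = 1 := rfl
theorem inv_x (g : SE3) : g⁻¹.x = -(g.Rᵀ *ᵥ g.x) := rfl
theorem inv_R (g : SE3) : g⁻¹.R = g.Rᵀ := rfl

instance : Group SE3 :=
  Group.ofLeftAxioms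
    (fun a b c => by
      ext1
      · simp only [mul_x, mul_R, Matrix.mulVec_add, Matrix.mulVec_mulVec, add_assoc]
      · simp only [mul_R, Matrix.mul_assoc])
    (fun a => by
      ext1
      · simp only [mul_x, one_x, one_R, Matrix.one_mulVec, zero_add]
      · simp only [mul_R, one_R, Matrix.one_mul])
    (fun a => by
      ext1
      · simp only [mul_x, inv_x, inv_R, one_x, neg_add_cancel]
      · simp only [mul_R, inv_R, one_R, a.orth])

/-- The homogeneous matrix `[R x; 0 1]` of a rigid motion. It embeds `SE(3)` as a closed Lie subgroup
of `GL(4, ℝ)`; regularity and velocities of curves in `SE(3)` are read off in this embedding. -/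
def toMat (g : SE3) : Mat4 :=
  Matrix.fromBlocks g.R (Matrix.replicateCol (Fin 1) g.x) 0 1

theorem toMat_mul (g h : SE3) : (g * h).toMat = g.toMat * h.toMat := by
  simp only [toMat, Matrix.fromBlocks_multiply, mul_x, mul_R]
  congr 1
  · simp
  · ext i j
    simp [Matrix.mul_apply, Matrix.mulVec, dotProduct, add_comm]
  · simp
  · simp

theorem toMat_one : (1 : SE3).toMat = 1 := by
  rw [toMat, one_x, one_R, ← Matrix.fromBlocks_one]
  congr 1

theorem toMat_injective : Function.Injective toMat := by
  intro g h hgh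
  rw [toMat, toMat, Matrix.fromBlocks_inj] at hgh
  ext1
  · ext i
    exact congrFun (congrFun hgh.2.1 i) 0
  · exact hgh.1

/-! ### The Lie algebra, the left-invariant frame and its coframe

The indices `1, …, 6` of the frame are `0, …, 5 : Fin 6` here, so that the horizontal directions
`3, 4, 5` are `2, 3, 4`. -/

/-- The infinitesimal rotation about the axis `(a, b, c)`, i.e. the matrix of `y ↦ (a, b, c) × y`. -/
def rotGen (a b c : ℝ) : Matrix (Fin 3) (Fin 3) ℝ :=
  !![0, -c, b; c, 0, -a; -b, a, 0]

/-- The element `∑ᵢ cⁱ Aᵢ` of the Lie algebra `T_e(SE(3))`. -/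
def lieElt (c : Fin 6 → ℝ) : Mat4 :=
  Matrix.fromBlocks (rotGen (c 3) (c 4) (c 5))
    (Matrix.replicateCol (Fin 1) ![c 0, c 1, c 2]) 0 0

/-- The basis `A₁, …, A₆` of `T_e(SE(3))`: the infinitesimal translations along the `x`, `y`, `z` axes,
followed by the infinitesimal rotations about these axes. -/
def A (i : Fin 6) : Mat4 := lieElt (Pi.single i 1)

theorem rotGen_add (a b c a' b' c' : ℝ) : rotGen (a + a') (b + b') (c + c') = rotGen a b c + rotGen a' b' c' := by
  simp [rotGen, add_comm]

theorem rotGen_smul (t a b c : ℝ) : rotGen (t * a) (t * b) (t * c) = t • rotGen a b c := by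
  simp [rotGen]

theorem lieElt_add (c d : Fin 6 → ℝ) : lieElt (c + d) = lieElt c + lieElt d := by
  simp only [lieElt, Matrix.fromBlocks_add, Pi.add_apply, rotGen_add, add_zero, Matrix.fromBlocks_inj, true_and, and_true]
  ext i j
  simp only [Matrix.replicateCol_apply, Matrix.add_apply]
  fin_cases i <;> rfl

theorem lieElt_smul (a : ℝ) (c : Fin 6 → ℝ) : lieElt (a • c) = a • lieElt c := by
  simp only [lieElt, Matrix.fromBlocks_smul, Pi.smul_apply, smul_eq_mul, rotGen_smul, smul_zero, Matrix.fromBlocks_inj, true_and, and_true]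
  ext i j
  simp only [Matrix.replicateCol_apply, Matrix.smul_apply]
  fin_cases i <;> rfl

theorem lieElt_eq_sum (c : Fin 6 → ℝ) : lieElt c = ∑ i, c i • A i := by
  let f : (Fin 6 → ℝ) →ₗ[ℝ] Mat4 := ⟨⟨lieElt, lieElt_add⟩, lieElt_smul⟩
  have h : f c = ∑ i, c i • f (Pi.single i 1) := by
    conv_lhs => rw [pi_eq_sum_univ' c, map_sum]
    refine Finset.sum_congr rfl fun i _ => ?_
    rw [map_smul]
  exact h

/-- The `i`-th coordinate of an element of `T_e(SE(3))` in the basis `A₁, …, A₆`. -/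
def coord (i : Fin 6) : Mat4 →ₗ[ℝ] ℝ :=
  ![Matrix.entryLinearMap ℝ ℝ (.inl 0) (.inr 0),
    Matrix.entryLinearMap ℝ ℝ (.inl 1) (.inr 0),
    Matrix.entryLinearMap ℝ ℝ (.inl 2) (.inr 0),
    Matrix.entryLinearMap ℝ ℝ (.inl 2) (.inl 1),
    Matrix.entryLinearMap ℝ ℝ (.inl 0) (.inl 2),
    Matrix.entryLinearMap ℝ ℝ (.inl 1) (.inl 0)] i

theorem coord_lieElt (i : Fin 6) (c : Fin 6 → ℝ) : coord i (lieElt c) = c i := by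
  fin_cases i <;> rfl

theorem coord_A (i j : Fin 6) : coord i (A j) = if i = j then 1 else 0 := by
  rw [A, coord_lieElt, Pi.single_apply]

/-- The left-invariant vector field `𝒜ᵢ` at `g`: the push-forward of `Aᵢ` under left multiplication
by `g`. -/
def frame (g : SE3) (i : Fin 6) : Mat4 := g.toMat * A i

/-- The covector `ωⁱ` of the dual coframe at `g`. (As a functional on the ambient space of matrices; only
its values on the tangent space of `SE(3)` at `g`, the span of the frame, matter.) -/
def coframe (g : SE3) (i : Fin 6) : Mat4 →ₗ[ℝ] ℝ :=
  coord i ∘ₗ LinearMap.mulLeft ℝ g⁻¹.toMat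

theorem coframe_frame (g : SE3) (i j : Fin 6) :
    coframe g i (frame g j) = if i = j then 1 else 0 := by
  rw [coframe, frame, LinearMap.comp_apply, LinearMap.mulLeft_apply, ← Matrix.mul_assoc, ← toMat_mul,
    inv_mul_cancel, toMat_one, Matrix.one_mul, coord_A]

/-- The structure constants `c^k_{ij}`, defined by `[Aᵢ, Aⱼ] = ∑ₖ c^k_{ij} Aₖ`. -/
def structConst (i j k : Fin 6) : ℝ := coord k ⁅A i, A j⁆

/-! ### The exponential map -/

section Exponential

attribute [local instance] Matrix.linftyOpNormedRing Matrix.linftyOpNormedAlgebra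

theorem hasSum_exp_entry {n : Type*} [Fintype n] [DecidableEq n] (X : Matrix n n ℝ) (i j : n) :
    HasSum (fun k : ℕ => ((k.factorial : ℝ)⁻¹ • X ^ k) i j) (NormedSpace.exp X i j) :=
  (NormedSpace.exp_series_hasSum_exp' (𝕂 := ℝ) X).map (Matrix.entryAddMonoidHom ℝ i j)
    (continuous_id.matrix_elem i j)

end Exponential

theorem exp_lieElt (c : Fin 6 → ℝ) :
    NormedSpace.exp (lieElt c) =
      Matrix.fromBlocks (NormedSpace.exp (rotGen (c 3) (c 4) (c 5)))
        (NormedSpace.exp (lieElt c)).toBlocks₁₂ 0 1 := by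
  have hpow : ∀ n : ℕ, ∃ B, (lieElt c) ^ n =
      Matrix.fromBlocks ((rotGen (c 3) (c 4) (c 5)) ^ n) B 0 (if n = 0 then 1 else 0) := by
    intro n
    induction n with
    | zero => exact ⟨0, by rw [pow_zero, pow_zero, if_pos rfl, Matrix.fromBlocks_one]⟩
    | succ n ih =>
      obtain ⟨B, hB⟩ := ih
      rw [pow_succ, hB, lieElt, Matrix.fromBlocks_multiply, if_neg (Nat.succ_ne_zero n), pow_succ]
      simp only [mul_zero, add_zero, Matrix.mul_zero, Matrix.zero_mul]
      exact ⟨_, rfl⟩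
  ext i j
  have h := hasSum_exp_entry (lieElt c) i j
  rcases i with i | i <;> rcases j with j | j
  · have e : (fun k : ℕ => ((k.factorial : ℝ)⁻¹ • lieElt c ^ k) (.inl i) (.inl j)) =
        fun k : ℕ => ((k.factorial : ℝ)⁻¹ • rotGen (c 3) (c 4) (c 5) ^ k) i j := by
      funext k
      obtain ⟨B, hB⟩ := hpow k
      rw [hB, Matrix.smul_apply, Matrix.smul_apply, Matrix.fromBlocks_apply₁₁]
    rw [e] at h
    exact h.unique (hasSum_exp_entry _ i j)
  · rfl
  · have e : (fun k : ℕ => ((k.factorial : ℝ)⁻¹ • lieElt c ^ k) (.inr i) (.inl j)) =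
        fun _ : ℕ => (0 : ℝ) := by
      funext k
      obtain ⟨B, hB⟩ := hpow k
      rw [hB, Matrix.smul_apply, Matrix.fromBlocks_apply₂₁, Matrix.zero_apply, smul_zero]
    rw [e] at h
    exact h.unique hasSum_zero
  · have e : (fun k : ℕ => ((k.factorial : ℝ)⁻¹ • lieElt c ^ k) (.inr i) (.inr j)) =
        fun k : ℕ => if k = 0 then (1 : Matrix (Fin 1) (Fin 1) ℝ) i j else 0 := by
      funext k
      obtain ⟨B, hB⟩ := hpow k
      rw [hB, Matrix.smul_apply, Matrix.fromBlocks_apply₂₂]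
      by_cases hk : k = 0
      · rw [if_pos hk, if_pos hk, hk, Nat.factorial_zero, Nat.cast_one, inv_one, one_smul]
      · rw [if_neg hk, if_neg hk, Matrix.zero_apply, smul_zero]
    rw [e] at h
    exact h.unique (hasSum_ite_eq 0 _)

theorem exp_rotGen_orth (a b c : ℝ) :
    (NormedSpace.exp (rotGen a b c))ᵀ * NormedSpace.exp (rotGen a b c) = 1 := by
  have h : (rotGen a b c)ᵀ = -rotGen a b c := by
    ext i j
    fin_cases i <;> fin_cases j <;> simp [rotGen]
  have hinv : IsUnit (NormedSpace.exp (rotGen a b c)).det :=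
    (Matrix.isUnit_iff_isUnit_det _).mp (Matrix.isUnit_exp _)
  rw [← Matrix.exp_transpose, h, Matrix.exp_neg, Matrix.nonsing_inv_mul _ hinv]

theorem exp_rotGen_det (a b c : ℝ) : (NormedSpace.exp (rotGen a b c)).det = 1 := by
  have h1 : (NormedSpace.exp (rotGen a b c)).det ^ 2 = 1 := by
    have h := congrArg Matrix.det (exp_rotGen_orth a b c)
    rwa [Matrix.det_mul, Matrix.det_transpose, Matrix.det_one, ← sq] at h
  have h2 : 0 ≤ (NormedSpace.exp (rotGen a b c)).det := by
    have h : rotGen a b c = 2 • rotGen (a / 2) (b / 2) (c / 2) := by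
      rw [two_nsmul, ← rotGen_add, add_halves, add_halves, add_halves]
    rw [h, Matrix.exp_nsmul, Matrix.det_pow]
    positivity
  nlinarith

/-- The exponential map `∑ᵢ cⁱ Aᵢ ↦ Exp (∑ᵢ cⁱ Aᵢ)` from the Lie algebra to `SE(3)`. -/
noncomputable def Exp (c : Fin 6 → ℝ) : SE3 where
  x := fun i => NormedSpace.exp (lieElt c) (.inl i) (.inr 0)
  R := NormedSpace.exp (rotGen (c 3) (c 4) (c 5))
  orth := exp_rotGen_orth _ _ _
  det_eq := exp_rotGen_det _ _ _

/-- In the matrix embedding, `Exp` is the matrix exponential. -/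
theorem toMat_Exp (c : Fin 6 → ℝ) : (Exp c).toMat = NormedSpace.exp (∑ i, c i • A i) := by
  rw [← lieElt_eq_sum, exp_lieElt, toMat]
  congr 1
  ext i j
  fin_cases j
  rfl

/-! ### Curves in `SE(3)` -/

/-- The curve `γ : I → SE(3)` is of class `C^n` on the interval `I`. -/
def CurveContDiffOn (n : WithTop ℕ∞) (γ : ℝ → SE3) (I : Set ℝ) : Prop :=
  ∀ i j, ContDiffOn ℝ n (fun t => (γ t).toMat i j) I

/-- The velocity `γ̇(s)` (one-sided at the end points of `I`). -/
noncomputable def velocity (γ : ℝ → SE3) (I : Set ℝ) (s : ℝ) : Mat4 :=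
  Matrix.of fun i j => derivWithin (fun t => (γ t).toMat i j) I s

/-- The component `γ̇ⁱ(s) = ⟨ωⁱ|_γ(s), γ̇(s)⟩` of the velocity in the left-invariant frame. -/
noncomputable def vel (γ : ℝ → SE3) (I : Set ℝ) (i : Fin 6) (s : ℝ) : ℝ :=
  coframe (γ s) i (velocity γ I s)

/-- The horizontal directions `3, 4, 5`. -/
def horiz : Finset (Fin 6) := {2, 3, 4}

/-- `γ` is horizontal: `⟨ωⁱ, γ̇⟩ = 0` for `i = 1, 2, 6`, i.e. `γ̇ ∈ Δ = span {𝒜₃, 𝒜₄, 𝒜₅}`. -/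
def IsHorizontal (γ : ℝ → SE3) (I : Set ℝ) : Prop :=
  ∀ s ∈ I, vel γ I 0 s = 0 ∧ vel γ I 1 s = 0 ∧ vel γ I 5 s = 0

/-- `γ = (x, R)` is parametrized by spatial arc length: `‖ẋ‖ = 1`. -/
def IsSpatialArcLength (γ : ℝ → SE3) (I : Set ℝ) : Prop :=
  ∀ s ∈ I, ∑ i, derivWithin (fun t => (γ t).x i) I s ^ 2 = 1

/-- `γ(s) = γ(0) Exp (s ∑ᵢ cⁱ Aᵢ)` for `s ∈ I`. -/
def IsExpCurve (γ : ℝ → SE3) (I : Set ℝ) (c : Fin 6 → ℝ) : Prop :=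
  ∀ s ∈ I, γ s = γ 0 * Exp (s • c)

/-! ### The connections -/

/-- The Cartan connection on `T(SE(3))`: for a vector field `V = ∑ₖ aᵏ 𝒜ₖ` along `γ`,
`∇_γ̇ V = ∑ₖ (ȧᵏ + ∑ᵢⱼ c^k_{ij} γ̇ⁱ aʲ) 𝒜ₖ`; so `∇_γ̇ 𝒜ⱼ = ∑ᵢₖ c^k_{ij} γ̇ⁱ 𝒜ₖ`. -/
noncomputable def cartan (γ : ℝ → SE3) (I : Set ℝ) (V : ℝ → Mat4) (s : ℝ) : Mat4 :=
  ∑ k, (derivWithin (fun t => coframe (γ t) k (V t)) I s +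
    ∑ i, ∑ j, structConst i j k * vel γ I i s * coframe (γ s) j (V s)) • frame (γ s) k

/-- The connection `∇̄` on the distribution `Δ`, for horizontal `γ` and a section
`V = ∑_{k ∈ {3,4,5}} aᵏ 𝒜ₖ` of `Δ` along `γ`. -/
noncomputable def cartanBar (γ : ℝ → SE3) (I : Set ℝ) (V : ℝ → Mat4) (s : ℝ) : Mat4 :=
  ∑ k ∈ horiz, (derivWithin (fun t => coframe (γ t) k (V t)) I s +
    ∑ i ∈ horiz, ∑ j ∈ horiz, structConst i j k * vel γ I i s * coframe (γ s) j (V s)) •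
      frame (γ s) k

/-- The action of `∇̄` on covector fields `Λ = ∑ₖ λₖ ωᵏ` of `T*(SE(3))` along a horizontal curve `γ`.
The connection form `∑_{i ∈ {3,4,5}} ωⁱ ⊗ ad(𝒜ᵢ)` of `∇̄` acts on all of `T(SE(3))`
(`∇̄_γ̇ 𝒜ⱼ = ∑_{i ∈ {3,4,5}} ∑ₖ c^k_{ij} γ̇ⁱ 𝒜ₖ`, followed by projection to `Δ` in `cartanBar`), and this is
its dual: `∇̄_γ̇ Λ = ∑ⱼ (λ̇ⱼ - ∑_{i ∈ {3,4,5}} ∑ₖ c^k_{ij} γ̇ⁱ λₖ) ωʲ`, where `λⱼ = ⟨Λ, 𝒜ⱼ⟩`. -/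
noncomputable def cartanBarDual (γ : ℝ → SE3) (I : Set ℝ) (Λ : ℝ → Module.Dual ℝ Mat4) (s : ℝ) :
    Module.Dual ℝ Mat4 :=
  ∑ j, (derivWithin (fun t => Λ t (frame (γ t) j)) I s -
    ∑ i ∈ horiz, ∑ k, structConst i j k * vel γ I i s * Λ s (frame (γ s) k)) • coframe (γ s) j

/-- `γ` is an autoparallel curve of `∇`: `∇_γ̇ γ̇ = 0` on `I`. -/
def IsAutoparallel (γ : ℝ → SE3) (I : Set ℝ) : Prop :=
  CurveContDiffOn 2 γ I ∧ ∀ s ∈ I, cartan γ I (velocity γ I) s = 0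

/-- `γ` is an autoparallel curve of `∇̄`: it is horizontal and `∇̄_γ̇ γ̇ = 0` on `I`. -/
def IsBarAutoparallel (γ : ℝ → SE3) (I : Set ℝ) : Prop :=
  CurveContDiffOn 2 γ I ∧ IsHorizontal γ I ∧ ∀ s ∈ I, cartanBar γ I (velocity γ I) s = 0

/-- The covector field `∑ᵢ λᵢ ωⁱ` along `γ`. -/
noncomputable def covector (γ : ℝ → SE3) (lam : ℝ → Fin 6 → ℝ) (s : ℝ) : Module.Dual ℝ Mat4 :=
  ∑ i, lam s i • coframe (γ s) i

/-! ### Stationary curves in the extended manifold -/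

/-- A point `(g, κ₁, κ₂, σ, λ₁, …, λ₆)` of the extended manifold `Z` (where moreover `σ > 0`). -/
structure ExtPoint where
  g : SE3
  κ₁ : ℝ
  κ₂ : ℝ
  σ : ℝ
  lam : Fin 6 → ℝ

/-- The values on the velocity of a curve in `Z` of the Pfaffian forms `θ¹ = ω¹`, `θ² = ω²`,
`θ³ = ω³ - ds`, `θ⁴ = ω⁴ + κ₂ ds`, `θ⁵ = ω⁵ - κ₁ ds`, `θ⁶ = ω⁶`, where `ds = σ dr`. -/
noncomputable def pfaff (Γ : ℝ → ExtPoint) (I : Set ℝ) (i : Fin 6) (r : ℝ) : ℝ :=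
  vel (fun t => (Γ t).g) I i r - (Γ r).σ * ![0, 0, 1, -(Γ r).κ₂, (Γ r).κ₁, 0] i

/-- The value on the velocity of a curve in `Z` of the one-form
`ψ = √(κ₁² + κ₂² + β²) ds + ∑ᵢ λᵢ θⁱ`. -/
noncomputable def psi (β : ℝ) (Γ : ℝ → ExtPoint) (I : Set ℝ) (r : ℝ) : ℝ :=
  √((Γ r).κ₁ ^ 2 + (Γ r).κ₂ ^ 2 + β ^ 2) * (Γ r).σ + ∑ i, (Γ r).lam i * pfaff Γ I i r

/-- The family `τ ↦ Φ τ` of curves `[0, ℓ] → Z`, `τ ∈ (-ε, ε)`, is a `C²` perturbation of `Γ` with fixed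
end points in `SE(3)`. -/
structure IsVariation (ℓ ε : ℝ) (Γ : ℝ → ExtPoint) (Φ : ℝ → ℝ → ExtPoint) : Prop where
  base : ∀ r ∈ Set.Icc 0 ℓ, Φ 0 r = Γ r
  smooth_g : ∀ i j, ContDiffOn ℝ 2 (fun p : ℝ × ℝ => (Φ p.1 p.2).g.toMat i j)
    (Set.Ioo (-ε) ε ×ˢ Set.Icc 0 ℓ)
  smooth_κ₁ : ContDiffOn ℝ 2 (fun p : ℝ × ℝ => (Φ p.1 p.2).κ₁) (Set.Ioo (-ε) ε ×ˢ Set.Icc 0 ℓ)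
  smooth_κ₂ : ContDiffOn ℝ 2 (fun p : ℝ × ℝ => (Φ p.1 p.2).κ₂) (Set.Ioo (-ε) ε ×ˢ Set.Icc 0 ℓ)
  smooth_σ : ContDiffOn ℝ 2 (fun p : ℝ × ℝ => (Φ p.1 p.2).σ) (Set.Ioo (-ε) ε ×ˢ Set.Icc 0 ℓ)
  smooth_lam : ∀ i, ContDiffOn ℝ 2 (fun p : ℝ × ℝ => (Φ p.1 p.2).lam i)
    (Set.Ioo (-ε) ε ×ˢ Set.Icc 0 ℓ)
  σ_pos : ∀ τ ∈ Set.Ioo (-ε) ε, ∀ r ∈ Set.Icc 0 ℓ, 0 < (Φ τ r).σ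
  left : ∀ τ ∈ Set.Ioo (-ε) ε, (Φ τ 0).g = (Γ 0).g
  right : ∀ τ ∈ Set.Ioo (-ε) ε, (Φ τ ℓ).g = (Γ ℓ).g

/-- `Γ : [0, ℓ] → Z` is a (`C²`) stationary curve of `∫ ψ`: for every perturbation with fixed end points
the derivative of `τ ↦ ∫ ψ` at `τ = 0` is zero. -/
def IsStationaryExt (β ℓ : ℝ) (Γ : ℝ → ExtPoint) : Prop :=
  (∃ ε > 0, IsVariation ℓ ε Γ fun _ => Γ) ∧
  ∀ (ε : ℝ) (Φ : ℝ → ℝ → ExtPoint), 0 < ε → IsVariation ℓ ε Γ Φ →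
    HasDerivAt (fun τ => ∫ r in (0 : ℝ)..ℓ, psi β (Φ τ) (Set.Icc 0 ℓ) r) 0 0

/-! ### Stationary curves of the energy in `ℝ³` and the momentum along their lifts -/

/-- The curvature `‖y' × y''‖ / ‖y'‖³` of a regular curve `y : [0, L] → ℝ³`. -/
noncomputable def curvature (L : ℝ) (y : ℝ → Fin 3 → ℝ) (u : ℝ) : ℝ :=
  let y₁ := derivWithin y (Set.Icc 0 L)
  let y₂ := derivWithin y₁ (Set.Icc 0 L)
  √((crossProduct (y₁ u) (y₂ u)) ⬝ᵥ (crossProduct (y₁ u) (y₂ u))) / √(y₁ u ⬝ᵥ y₁ u) ^ 3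

/-- The energy `∫ √(κ² + β²) ds` of a regular curve `y : [0, L] → ℝ³`, with `ds = ‖y'(u)‖ du`. -/
noncomputable def energy (β L : ℝ) (y : ℝ → Fin 3 → ℝ) : ℝ :=
  ∫ u in (0 : ℝ)..L, √(curvature L y u ^ 2 + β ^ 2) *
    √(derivWithin y (Set.Icc 0 L) u ⬝ᵥ derivWithin y (Set.Icc 0 L) u)

/-- `x : [0, L] → ℝ³` is a stationary curve of the energy, parametrized by arc length: the first variation
vanishes for every smooth perturbation supported in `(0, L)` (these are perturbations which keep the end
points and the end directions). -/
def IsStationaryCurve (β L : ℝ) (x : ℝ → Fin 3 → ℝ) : Prop :=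
  ContDiffOn ℝ 4 x (Set.Icc 0 L) ∧
  (∀ s ∈ Set.Icc 0 L, derivWithin x (Set.Icc 0 L) s ⬝ᵥ derivWithin x (Set.Icc 0 L) s = 1) ∧
  ∀ δ : ℝ → Fin 3 → ℝ, ContDiff ℝ ∞ δ → tsupport δ ⊆ Set.Ioo 0 L →
    HasDerivAt (fun h : ℝ => energy β L fun u => x u + h • δ u) 0 0

/-- `γ : [0, L] → SE(3)` is a horizontal curve with `ω³(γ̇) = 1`, i.e. a horizontal lift of its spatial part
`x`, parametrized by arc length: `ẋ = R e_z` and `ω⁶(γ̇) = 0`. -/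
def IsHorizontalLift (L : ℝ) (γ : ℝ → SE3) : Prop :=
  CurveContDiffOn 3 γ (Set.Icc 0 L) ∧ IsHorizontal γ (Set.Icc 0 L) ∧
  ∀ s ∈ Set.Icc 0 L, vel γ (Set.Icc 0 L) 2 s = 1

/-- The normalized curvatures `w₁, w₂ = (κ₁, κ₂) / √(κ² + β²)`, where `κ₁ = ω⁵(γ̇)`, `κ₂ = -ω⁴(γ̇)`. -/
noncomputable def w₁ (β L : ℝ) (γ : ℝ → SE3) (s : ℝ) : ℝ :=
  vel γ (Set.Icc 0 L) 4 s /
    √(vel γ (Set.Icc 0 L) 4 s ^ 2 + vel γ (Set.Icc 0 L) 3 s ^ 2 + β ^ 2)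

/-- The second normalized curvature, see `w₁`. -/
noncomputable def w₂ (β L : ℝ) (γ : ℝ → SE3) (s : ℝ) : ℝ :=
  -vel γ (Set.Icc 0 L) 3 s /
    √(vel γ (Set.Icc 0 L) 4 s ^ 2 + vel γ (Set.Icc 0 L) 3 s ^ 2 + β ^ 2)

/-- The components of the momentum (the Lagrange multipliers)
`(-ẇ₁, -ẇ₂, β √(1 - ‖w‖²), -w₂, w₁, 0)` along the lift of a stationary curve. -/
noncomputable def momentum (β L : ℝ) (γ : ℝ → SE3) (s : ℝ) : Fin 6 → ℝ :=
  ![-derivWithin (w₁ β L γ) (Set.Icc 0 L) s, -derivWithin (w₂ β L γ) (Set.Icc 0 L) s,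
    β * √(1 - (w₁ β L γ s ^ 2 + w₂ β L γ s ^ 2)), -w₂ β L γ s, w₁ β L γ s, 0]

end SE3

/-! Write `γ̇ = γ X` with `X = ∑ γ̇ⁱ Aᵢ` in the Lie algebra. The structure constants are
antisymmetric, so the quadratic term drops out of `∇_γ̇ γ̇` and of `∇̄_γ̇ γ̇`. Autoparallel thus
means that the components of `X` are constant; for `∇̄` the three non-horizontal ones are zero
anyway. If `X` is constant, `γ exp(-sX)` has zero derivative, which makes `γ` an exponential curve
(`isExpCurve_of_vel_eq`). Conversely, an exponential curve has components `cⁱ`, and its spatial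
speed is the length of `(c¹, c², c³)` because `R` is orthogonal.

Along a horizontal curve the sum over `{3,4,5}` in the dual connection is the full `ad X`. Hence
`∇̄_γ̇ λ = 0` is the system `λ̇ⱼ = ⟨λ, [X, Aⱼ]⟩` (`cartanBarDual_covector_eq_zero`).

In the extended manifold this system is the Euler-Lagrange equation of `∫ ψ`. Varying `λᵢ` gives
`θⁱ(Γ̇) = 0`, hence horizontality. Replacing `γ` by `γ Exp(τ φ Aᵢ)` changes `X` to first order by `τ
(φ [X, Aᵢ] + φ' Aᵢ)` and affects nothing else in `ψ`; an integration by parts isolates `λ̇ᵢ`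
(`IsStationaryExt.derivWithin_lam`).

For space curves let `T` be the unit tangent, `K` the curvature vector and `D = √(κ² + β²)`. The
first variation in direction `δ` is `∫ δ''·K/D + δ'·T (β² - κ²)/D` (`hasDerivAt_energy`). With `W =
K/D` this says that the spatial momentum `P = T (β² - κ²)/D - W'` is constant. In the frame of the
columns of `R`, of which the third is `T` and the other two are rotation minimizing, `P` has
components `(λ₁, λ₂, λ₃)`, so `P' = 0` yields the first three equations
(`IsStationaryCurve.euler_lagrange`). Those for `λ₄` and `λ₅` hold by the choice of `λ₂` and `λ₁`,
and the sixth holds because `(w₁, w₂)` is parallel to `(κ₁, κ₂)`. -/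

/-! ### Calculus of variations on a compact interval. -/

open MeasureTheory Set in
/-- Differentiation under the integral sign over a compact interval. -/
theorem hasDerivAt_integral_of_continuousOn_deriv {ε ℓ : ℝ} (hε : 0 < ε) (hℓ : 0 ≤ ℓ)
    {F F' : ℝ → ℝ → ℝ} (hF : ∀ h ∈ Icc (-ε) ε, ContinuousOn (F h) (Icc 0 ℓ))
    (hF' : ContinuousOn (fun p : ℝ × ℝ => F' p.1 p.2) (Icc (-ε) ε ×ˢ Icc 0 ℓ))
    (hd : ∀ h ∈ Icc (-ε) ε, ∀ r ∈ Icc 0 ℓ, HasDerivAt (fun h => F h r) (F' h r) h) :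
    HasDerivAt (fun h => ∫ r in (0 : ℝ)..ℓ, F h r) (∫ r in (0 : ℝ)..ℓ, F' 0 r) 0 := by
  -- A continuous `F'` is bounded on the compact rectangle, and this constant is the dominating
  -- function.
  obtain ⟨C, hC⟩ := (isCompact_Icc.prod isCompact_Icc).exists_bound_of_continuousOn hF'
  have hnhds : Icc (-ε) ε ∈ nhds (0 : ℝ) := Icc_mem_nhds (by linarith) hε
  have hsub : uIoc 0 ℓ ⊆ Icc 0 ℓ := by
    rw [uIoc_of_le hℓ]
    exact Ioc_subset_Icc_self
  have h0 : (0 : ℝ) ∈ Icc (-ε) ε := ⟨by linarith, hε.le⟩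
  have hF'0 : ContinuousOn (F' 0) (Icc 0 ℓ) :=
    hF'.comp (f := fun r : ℝ => ((0 : ℝ), r)) (by fun_prop) fun r hr => ⟨h0, hr⟩
  refine (intervalIntegral.hasDerivAt_integral_of_dominated_loc_of_deriv_le (bound := fun _ => C)
    hnhds ?_ ?_ ?_ ?_ ?_ ?_).2
  · filter_upwards [hnhds] with h hh
    exact ((hF h hh).mono hsub).aestronglyMeasurable measurableSet_uIoc
  · exact ((hF 0 h0).mono (by rw [uIcc_of_le hℓ])).intervalIntegrable
  · exact (hF'0.mono hsub).aestronglyMeasurable measurableSet_uIoc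
  · exact Filter.Eventually.of_forall fun r hr h hh => hC (h, r) ⟨hh, hsub hr⟩
  · simp
  · exact Filter.Eventually.of_forall fun r hr h hh => hd h hh r (hsub hr)

open MeasureTheory Set in
/-- The fundamental lemma of the calculus of variations on a compact interval. -/
theorem eqOn_zero_of_integral_contDiff_mul_eq_zero {ℓ : ℝ} (hℓ : 0 < ℓ) {f : ℝ → ℝ}
    (hf : ContinuousOn f (Icc 0 ℓ))
    (h : ∀ φ : ℝ → ℝ, ContDiff ℝ ∞ φ → tsupport φ ⊆ Ioo 0 ℓ → ∫ r in (0 : ℝ)..ℓ, φ r * f r = 0) :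
    ∀ r ∈ Icc 0 ℓ, f r = 0 := by
  have hae : ∀ᵐ r ∂volume, r ∈ Ioo 0 ℓ → f r = 0 := by
    refine isOpen_Ioo.ae_eq_zero_of_integral_contDiff_smul_eq_zero
      ((hf.integrableOn_Icc.mono_set Ioo_subset_Icc_self).locallyIntegrableOn)
      fun φ hφ _ hsupp => ?_
    rw [← h φ hφ hsupp, intervalIntegral.integral_of_le hℓ.le, integral_Ioc_eq_integral_Ioo,
      setIntegral_eq_integral_of_forall_compl_eq_zero]
    · simp
    · intro r hr
      rw [image_eq_zero_of_notMem_tsupport fun hr' => hr (hsupp hr'), zero_mul]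
  -- Continuity upgrades almost everywhere on the open interval to everywhere, end points included.
  refine Measure.eqOn_Icc_of_ae_eq volume hℓ.ne (f := f) (g := fun _ => 0) ?_ hf
    continuousOn_const
  rw [Filter.EventuallyEq, ← restrict_Ioo_eq_restrict_Icc, ae_restrict_iff' measurableSet_Ioo]
  exact hae

open Set in
/-- Integration by parts against a function that vanishes at the end points. -/
theorem integral_mul_deriv_of_eq_zero {ℓ : ℝ} (hℓ : 0 ≤ ℓ) {f f' φ φ' : ℝ → ℝ}
    (hf : ∀ r ∈ Icc 0 ℓ, HasDerivWithinAt f (f' r) (Icc 0 ℓ) r)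
    (hf' : ContinuousOn f' (Icc 0 ℓ)) (hφ : ∀ r, HasDerivAt φ (φ' r) r) (hφ' : Continuous φ')
    (h0 : φ 0 = 0) (h1 : φ ℓ = 0) :
    ∫ r in (0 : ℝ)..ℓ, f r * φ' r = -∫ r in (0 : ℝ)..ℓ, φ r * f' r := by
  rw [← uIcc_of_le hℓ] at hf hf'
  rw [intervalIntegral.integral_mul_deriv_eq_deriv_mul_of_hasDerivWithinAt hf
    (fun r _ => (hφ r).hasDerivWithinAt) hf'.intervalIntegrable (hφ'.intervalIntegrable _ _), h0, h1]
  simp [mul_comm]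

open Set in
theorem eq_zero_left_of_tsupport_subset_Ioo {ℓ : ℝ} {φ : ℝ → ℝ} (h : tsupport φ ⊆ Ioo 0 ℓ) :
    φ 0 = 0 :=
  image_eq_zero_of_notMem_tsupport fun h' => (h h').1.ne rfl

open Set in
theorem eq_zero_right_of_tsupport_subset_Ioo {ℓ : ℝ} {φ : ℝ → ℝ} (h : tsupport φ ⊆ Ioo 0 ℓ) :
    φ ℓ = 0 :=
  image_eq_zero_of_notMem_tsupport fun h' => (h h').2.ne rfl

/-- A nontrivial order-connected set of real numbers has unique derivatives. -/
theorem Set.OrdConnected.uniqueDiffOn {I : Set ℝ} (hI : I.OrdConnected) (hn : I.Nontrivial) :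
    UniqueDiffOn ℝ I := by
  refine uniqueDiffOn_convex hI.convex ?_
  obtain ⟨a, ha, b, hb, hab⟩ := hn.exists_lt
  refine ⟨(a + b) / 2, mem_interior_iff_mem_nhds.mpr ?_⟩
  exact Filter.mem_of_superset (Icc_mem_nhds (by linarith) (by linarith)) (hI.out ha hb)

namespace SE3

/-! ### Velocities of curves in the matrix embedding. -/

section Velocity

attribute [local instance] Matrix.linftyOpNormedRing Matrix.linftyOpNormedAlgebra

theorem hasDerivWithinAt_mat_iff {M : ℝ → Mat4} {V : Mat4} {I : Set ℝ} {s : ℝ} :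
    HasDerivWithinAt M V I s ↔
      ∀ i j, HasDerivWithinAt (fun t => M t i j) (V i j) I s := by
  constructor
  · intro h i j
    exact (LinearMap.toContinuousLinearMap (Matrix.entryLinearMap ℝ ℝ i j)).hasFDerivAt
      |>.comp_hasDerivWithinAt s h
  · intro h
    -- Expanding in matrix units reduces the matrix derivative to a finite sum of scalar ones.
    have h2 : HasDerivWithinAt (fun t => ∑ i, ∑ j, M t i j • Matrix.single i j (1 : ℝ))
        (∑ i, ∑ j, V i j • Matrix.single i j (1 : ℝ)) I s :=
      HasDerivWithinAt.fun_sum fun i _ => HasDerivWithinAt.fun_sum fun j _ =>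
        (h i j).smul_const _
    simp only [Matrix.smul_single, smul_eq_mul, mul_one] at h2
    rw [← Matrix.matrix_eq_sum_single V] at h2
    convert h2 using 2 with t
    exact Matrix.matrix_eq_sum_single (M t)

theorem CurveContDiffOn.hasDerivWithinAt {n : WithTop ℕ∞} {γ : ℝ → SE3} {I : Set ℝ} {s : ℝ}
    (h : CurveContDiffOn n γ I) (hn : n ≠ 0) (hs : s ∈ I) :
    HasDerivWithinAt (fun t => (γ t).toMat) (velocity γ I s) I s :=
  hasDerivWithinAt_mat_iff.mpr fun i j =>
    ((h i j).differentiableOn hn s hs).hasDerivWithinAt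

theorem velocity_eq {γ : ℝ → SE3} {I : Set ℝ} {s : ℝ} {V : Mat4}
    (h : HasDerivWithinAt (fun t => (γ t).toMat) V I s) (hI : UniqueDiffWithinAt ℝ I s) :
    velocity γ I s = V := by
  ext i j
  exact (hasDerivWithinAt_mat_iff.mp h i j).derivWithin hI

theorem toMat_inv_mul_self (g : SE3) : g⁻¹.toMat * g.toMat = 1 := by
  rw [← toMat_mul, inv_mul_cancel, toMat_one]

theorem toMat_mul_inv_self (g : SE3) : g.toMat * g⁻¹.toMat = 1 := by
  rw [← toMat_mul, mul_inv_cancel, toMat_one]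

theorem vel_eq {γ : ℝ → SE3} {I : Set ℝ} {s : ℝ} {c : Fin 6 → ℝ}
    (h : HasDerivWithinAt (fun t => (γ t).toMat) ((γ s).toMat * lieElt c) I s)
    (hI : UniqueDiffWithinAt ℝ I s) (i : Fin 6) : vel γ I i s = c i := by
  rw [vel, velocity_eq h hI, coframe, LinearMap.comp_apply, LinearMap.mulLeft_apply,
    ← Matrix.mul_assoc, toMat_inv_mul_self, Matrix.one_mul, coord_lieElt]

/-- A matrix with antisymmetric upper left block and vanishing last row is an element of the Lie
algebra. -/
theorem eq_lieElt_of_antisymm {N : Mat4} (h : ∀ i j, N (.inl i) (.inl j) + N (.inl j) (.inl i) = 0)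
    (h' : ∀ j, N (.inr 0) j = 0) : N = lieElt fun i => coord i N := by
  have d : ∀ i, N (.inl i) (.inl i) = 0 := fun i => by linarith [h i i]
  have e : ∀ i j, N (.inl i) (.inl j) = -N (.inl j) (.inl i) := fun i j => by linarith [h i j]
  ext i j
  rcases i with i | i
  · rcases j with j | j
    · fin_cases i <;> fin_cases j <;> first | exact d _ | rfl | exact e _ _
    · fin_cases j; fin_cases i <;> rfl
  · fin_cases i
    rw [show ((⟨0, by decide⟩ : Fin 1)) = 0 from rfl, h' j]
    rcases j with j | j <;> rfl

/-- Differentiating `Rᵀ R = 1` makes the rotation block antisymmetric, and the last row of `toMat`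
is constant. -/
theorem inv_toMat_mul_deriv {γ : ℝ → SE3} {I : Set ℝ} {s : ℝ} {V : Mat4}
    (h : HasDerivWithinAt (fun t => (γ t).toMat) V I s) (hI : UniqueDiffWithinAt ℝ I s) :
    (γ s)⁻¹.toMat * V = lieElt fun i => coord i ((γ s)⁻¹.toMat * V) := by
  have hV := hasDerivWithinAt_mat_iff.mp h
  have hlast : ∀ j, V (.inr 0) j = 0 := by
    intro j
    refine (hI.eq_deriv _ (hV (.inr 0) j) ?_)
    rcases j with j | j
    · exact hasDerivWithinAt_const s I 0
    · exact hasDerivWithinAt_const s I ((1 : Matrix (Fin 1) (Fin 1) ℝ) 0 j)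
  have hR : ∀ i j, HasDerivWithinAt (fun t => (γ t).R i j) (V (.inl i) (.inl j)) I s :=
    fun i j => hV (.inl i) (.inl j)
  have hN : ∀ i j, ((γ s)⁻¹.toMat * V) (.inl i) j = ∑ k, (γ s).R k i * V (.inl k) j := by
    intro i j
    rw [Matrix.mul_apply, Fintype.sum_sum_type, Fin.sum_univ_one, hlast, mul_zero, add_zero]
    rfl
  refine eq_lieElt_of_antisymm (fun i j => ?_) fun j => ?_
  · have h1 : HasDerivWithinAt (fun t => ∑ k, (γ t).R k i * (γ t).R k j)
        (∑ k, (V (.inl k) (.inl i) * (γ s).R k j + (γ s).R k i * V (.inl k) (.inl j))) I s :=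
      HasDerivWithinAt.fun_sum fun k _ => (hR k i).mul (hR k j)
    have h2 : (fun t => ∑ k, (γ t).R k i * (γ t).R k j) =
        fun _ => (1 : Matrix (Fin 3) (Fin 3) ℝ) i j := by
      funext t
      rw [← (γ t).orth, Matrix.mul_apply]
      rfl
    rw [h2] at h1
    rw [hN, hN, ← Finset.sum_add_distrib, ← hI.eq_deriv _ h1 (hasDerivWithinAt_const _ _ _)]
    exact Finset.sum_congr rfl fun k _ => by ring
  · rw [Matrix.mul_apply, Fintype.sum_sum_type, Fin.sum_univ_one, hlast, mul_zero, add_zero]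
    exact Finset.sum_eq_zero fun k _ => zero_mul _

/-- The velocity of a differentiable curve is tangent to `SE(3)`: `γ̇ = γ ∑ᵢ γ̇ⁱ Aᵢ`. -/
theorem CurveContDiffOn.hasDerivWithinAt_lieElt {n : WithTop ℕ∞} {γ : ℝ → SE3} {I : Set ℝ} {s : ℝ}
    (h : CurveContDiffOn n γ I) (hn : n ≠ 0) (hs : s ∈ I) (hI : UniqueDiffWithinAt ℝ I s) :
    HasDerivWithinAt (fun t => (γ t).toMat)
      ((γ s).toMat * lieElt fun i => vel γ I i s) I s := by
  have h1 := h.hasDerivWithinAt hn hs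
  have h2 := inv_toMat_mul_deriv h1 hI
  have h3 : (lieElt fun i => vel γ I i s) = (γ s)⁻¹.toMat * velocity γ I s := h2.symm
  rw [h3, ← Matrix.mul_assoc, toMat_mul_inv_self, Matrix.one_mul]
  exact h1

/-- Since `R⁻¹ = Rᵀ`, the entries of the inverse are polynomials in those of `γ`. -/
theorem CurveContDiffOn.inv {n : WithTop ℕ∞} {γ : ℝ → SE3} {I : Set ℝ}
    (h : CurveContDiffOn n γ I) : CurveContDiffOn n (fun t => (γ t)⁻¹) I := by
  have hR : ∀ i j, ContDiffOn ℝ n (fun t => (γ t).R i j) I := fun i j => h (.inl i) (.inl j)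
  have hx : ∀ i, ContDiffOn ℝ n (fun t => (γ t).x i) I := fun i => h (.inl i) (.inr 0)
  intro i j
  rcases i with i | i <;> rcases j with j | j
  · exact hR j i
  · change ContDiffOn ℝ n (fun t => -∑ k, (γ t).R k i * (γ t).x k) I
    exact (ContDiffOn.sum fun k _ => (hR k i).mul (hx k)).neg
  · exact contDiffOn_const
  · exact contDiffOn_const

theorem contDiffOn_coord_mul {n : WithTop ℕ∞} {E : Type*} [NormedAddCommGroup E] [NormedSpace ℝ E]
    {M N : E → Mat4} {I : Set E}
    (hM : ∀ i j, ContDiffOn ℝ n (fun t => M t i j) I)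
    (hN : ∀ i j, ContDiffOn ℝ n (fun t => N t i j) I) (k : Fin 6) :
    ContDiffOn ℝ n (fun t => coord k (M t * N t)) I := by
  have h : ∀ i j, ContDiffOn ℝ n (fun t => (M t * N t) i j) I := fun i j => by
    simp only [Matrix.mul_apply]
    exact ContDiffOn.sum fun l _ => (hM i l).mul (hN l j)
  fin_cases k <;> exact h _ _

/-- The components are entries of `γ⁻¹ γ̇`, so only the one derivative in `γ̇` is lost. -/
theorem CurveContDiffOn.contDiffOn_vel {m n : WithTop ℕ∞} {γ : ℝ → SE3} {I : Set ℝ}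
    (h : CurveContDiffOn n γ I) (hI : UniqueDiffOn ℝ I) (hmn : m + 1 ≤ n) (k : Fin 6) :
    ContDiffOn ℝ m (vel γ I k) I :=
  contDiffOn_coord_mul (fun i j => (h.inv i j).of_le (le_trans le_self_add hmn))
    (fun i j => (h i j).derivWithin hI hmn) k

theorem contDiff_exp_smul_const {𝔸 : Type*} [NormedRing 𝔸] [NormedAlgebra ℝ 𝔸] [CompleteSpace 𝔸]
    {n : WithTop ℕ∞} (X : 𝔸) : ContDiff ℝ n fun t : ℝ => NormedSpace.exp (t • X) := by
  let : NormedAlgebra ℚ 𝔸 := .restrictScalars ℚ ℝ 𝔸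
  have h : ContDiff ℝ n (NormedSpace.exp : 𝔸 → 𝔸) :=
    contDiff_iff_contDiffAt.mpr fun x => (NormedSpace.exp_analytic (𝕂 := ℝ) x).contDiffAt
  exact h.comp (contDiff_id.smul contDiff_const)

theorem contDiff_exp_smul {n : WithTop ℕ∞} (X : Mat4) (i j) :
    ContDiff ℝ n fun t : ℝ => NormedSpace.exp (t • X) i j := by
  have h1 : ContDiff ℝ n fun t : ℝ => NormedSpace.exp (t • X) := contDiff_exp_smul_const X
  let e : Mat4 →L[ℝ] ℝ := (Matrix.entryLinearMap ℝ ℝ i j).toContinuousLinearMap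
  have h2 : ContDiff ℝ n e := e.contDiff
  exact h2.comp h1

theorem toMat_Exp_smul (t : ℝ) (c : Fin 6 → ℝ) :
    (Exp (t • c)).toMat = NormedSpace.exp (t • lieElt c) := by
  rw [toMat_Exp, ← lieElt_eq_sum, lieElt_smul]

theorem hasDerivAt_exp_smul (X : Mat4) (t : ℝ) :
    HasDerivAt (fun u : ℝ => NormedSpace.exp (u • X)) (NormedSpace.exp (t • X) * X) t :=
  hasDerivAt_exp_smul_const X t

theorem exp_smul_neg_mul_exp_smul (X : Mat4) (t : ℝ) :
    NormedSpace.exp (-(t • X)) * NormedSpace.exp (t • X) = 1 := by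
  have h : IsUnit (NormedSpace.exp (t • X)).det :=
    (Matrix.isUnit_iff_isUnit_det _).mp (Matrix.isUnit_exp _)
  rw [Matrix.exp_neg, Matrix.nonsing_inv_mul _ h]

/-- A curve with constant velocity components is an exponential curve. -/
theorem isExpCurve_of_vel_eq {n : WithTop ℕ∞} {γ : ℝ → SE3} {I : Set ℝ} {c : Fin 6 → ℝ}
    (hI : I.OrdConnected) (hn : I.Nontrivial) (h0 : 0 ∈ I) (h : CurveContDiffOn n γ I) (hn' : n ≠ 0)
    (hc : ∀ s ∈ I, ∀ i, vel γ I i s = c i) : IsExpCurve γ I c := by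
  have hU := hI.uniqueDiffOn hn
  -- With `X = lieElt c`, the terms `γ X exp(-sX)` and `-γ X exp(-sX)` of the product rule cancel.
  have hd : ∀ s ∈ I, HasDerivWithinAt
      (fun t => (γ t).toMat * NormedSpace.exp (t • -lieElt c)) 0 I s := by
    intro s hs
    have h1 := h.hasDerivWithinAt_lieElt hn' hs (hU s hs)
    rw [show (fun i => vel γ I i s) = c from funext (hc s hs)] at h1
    have h2 := h1.mul (hasDerivAt_exp_smul_const' (-lieElt c) s).hasDerivWithinAt
    have h3 : (γ s).toMat * lieElt c * NormedSpace.exp (s • -lieElt c) +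
        (γ s).toMat * (-lieElt c * NormedSpace.exp (s • -lieElt c)) = 0 := by
      rw [Matrix.neg_mul, Matrix.mul_neg, Matrix.mul_assoc, add_neg_cancel]
    rw [← h3]
    exact h2
  intro s hs
  have h1 : (γ s).toMat * NormedSpace.exp (s • -lieElt c) =
      (γ 0).toMat * NormedSpace.exp ((0 : ℝ) • -lieElt c) := by
    ext i j
    exact hI.convex.is_const_of_fderivWithin_eq_zero (𝕜 := ℝ)
      (f := fun t => ((γ t).toMat * NormedSpace.exp (t • -lieElt c)) i j)
      (fun t ht => (hasDerivWithinAt_mat_iff.mp (hd t ht) i j).differentiableWithinAt)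
      (fun t ht => by
        rw [(hasDerivWithinAt_mat_iff.mp (hd t ht) i j).hasFDerivWithinAt.fderivWithin (hU t ht)]
        ext1
        simp) hs h0
  rw [zero_smul, NormedSpace.exp_zero, mul_one, smul_neg] at h1
  apply toMat_injective
  rw [toMat_mul, toMat_Exp_smul, ← h1, Matrix.mul_assoc, exp_smul_neg_mul_exp_smul, Matrix.mul_one]

theorem IsExpCurve.hasDerivWithinAt {γ : ℝ → SE3} {I : Set ℝ} {c : Fin 6 → ℝ}
    (h : IsExpCurve γ I c) {s : ℝ} (hs : s ∈ I) :
    HasDerivWithinAt (fun t => (γ t).toMat) ((γ s).toMat * lieElt c) I s := by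
  have h1 : HasDerivWithinAt (fun t : ℝ => (γ 0).toMat * NormedSpace.exp (t • lieElt c))
      ((γ 0).toMat * (NormedSpace.exp (s • lieElt c) * lieElt c)) I s :=
    ((hasDerivAt_exp_smul (lieElt c) s).const_mul (γ 0).toMat).hasDerivWithinAt
  rw [← Matrix.mul_assoc, ← toMat_Exp_smul, ← toMat_mul, ← h s hs] at h1
  refine h1.congr_of_mem (fun t ht => ?_) hs
  rw [h t ht, toMat_mul, toMat_Exp_smul]

theorem IsExpCurve.curveContDiffOn {n : WithTop ℕ∞} {γ : ℝ → SE3} {I : Set ℝ} {c : Fin 6 → ℝ}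
    (h : IsExpCurve γ I c) : CurveContDiffOn n γ I := by
  intro i j
  have h1 : ContDiff ℝ n fun t : ℝ => ((γ 0).toMat * NormedSpace.exp (t • lieElt c)) i j := by
    simp only [Matrix.mul_apply]
    exact ContDiff.sum fun l _ => contDiff_const.mul (contDiff_exp_smul _ l j)
  refine h1.contDiffOn.congr fun t ht => ?_
  rw [h t ht, toMat_mul, toMat_Exp_smul]

end Velocity

/-! ### Autoparallel curves are exponential curves. -/

theorem structConst_swap (i j k : Fin 6) : structConst i j k = -structConst j i k := by
  rw [structConst, structConst, ← map_neg, Ring.lie_def, Ring.lie_def, neg_sub]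

theorem sum_sum_eq_zero_of_antisymm {S : Finset (Fin 6)} {a : Fin 6 → Fin 6 → ℝ}
    (h : ∀ i j, a i j = -a j i) : ∑ i ∈ S, ∑ j ∈ S, a i j = 0 := by
  have h1 : ∑ i ∈ S, ∑ j ∈ S, a i j = -∑ i ∈ S, ∑ j ∈ S, a i j := by
    conv_lhs => rw [Finset.sum_comm]
    rw [← Finset.sum_neg_distrib]
    refine Finset.sum_congr rfl fun i _ => ?_
    rw [← Finset.sum_neg_distrib]
    exact Finset.sum_congr rfl fun j _ => h j i
  linarith

/-- An antisymmetric form vanishes on the diagonal. This removes the connection term when the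
transported field is the velocity itself, for all indices as well as for the horizontal ones. -/
theorem sum_structConst_self (S : Finset (Fin 6)) (v : Fin 6 → ℝ) (k : Fin 6) :
    ∑ i ∈ S, ∑ j ∈ S, structConst i j k * v i * v j = 0 :=
  sum_sum_eq_zero_of_antisymm (a := fun i j => structConst i j k * v i * v j) fun i j => by
    rw [structConst_swap]; ring

theorem coframe_sum_frame (g : SE3) (S : Finset (Fin 6)) (a : Fin 6 → ℝ) (k : Fin 6) :
    coframe g k (∑ i ∈ S, a i • frame g i) = if k ∈ S then a k else 0 := by
  simp [map_sum, coframe_frame]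

theorem cartan_velocity (γ : ℝ → SE3) (I : Set ℝ) (s : ℝ) :
    cartan γ I (velocity γ I) s = ∑ k, derivWithin (vel γ I k) I s • frame (γ s) k := by
  refine Finset.sum_congr rfl fun k _ => ?_
  congr 1
  exact add_eq_left.mpr (sum_structConst_self Finset.univ (fun i => vel γ I i s) k)

theorem cartanBar_velocity (γ : ℝ → SE3) (I : Set ℝ) (s : ℝ) :
    cartanBar γ I (velocity γ I) s = ∑ k ∈ horiz, derivWithin (vel γ I k) I s • frame (γ s) k := by
  refine Finset.sum_congr rfl fun k _ => ?_
  congr 1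
  exact add_eq_left.mpr (sum_structConst_self horiz (fun i => vel γ I i s) k)

section Interval

variable {I : Set ℝ} {γ : ℝ → SE3} {c : Fin 6 → ℝ}

theorem IsExpCurve.vel_eq (h : IsExpCurve γ I c) (hI : UniqueDiffOn ℝ I) {s : ℝ} (hs : s ∈ I)
    (i : Fin 6) : vel γ I i s = c i :=
  SE3.vel_eq (h.hasDerivWithinAt hs) (hI s hs) i

theorem IsExpCurve.derivWithin_vel (h : IsExpCurve γ I c) (hI : UniqueDiffOn ℝ I) {s : ℝ}
    (hs : s ∈ I) (i : Fin 6) : derivWithin (vel γ I i) I s = 0 := by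
  rw [derivWithin_congr (fun t ht => h.vel_eq hI ht i) (h.vel_eq hI hs i)]
  exact congrFun (derivWithin_const I (c i)) s

theorem IsExpCurve.isAutoparallel (h : IsExpCurve γ I c) (hI : UniqueDiffOn ℝ I) :
    IsAutoparallel γ I := by
  refine ⟨h.curveContDiffOn, fun s hs => ?_⟩
  rw [cartan_velocity]
  exact Finset.sum_eq_zero fun k _ => by rw [h.derivWithin_vel hI hs, zero_smul]

theorem IsExpCurve.isBarAutoparallel (h : IsExpCurve γ I c) (hI : UniqueDiffOn ℝ I)
    (hγ : IsHorizontal γ I) : IsBarAutoparallel γ I := by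
  refine ⟨h.curveContDiffOn, hγ, fun s hs => ?_⟩
  rw [cartanBar_velocity]
  exact Finset.sum_eq_zero fun k _ => by rw [h.derivWithin_vel hI hs, zero_smul]

theorem IsExpCurve.isHorizontal (h : IsExpCurve γ I c) (hI : UniqueDiffOn ℝ I)
    (hc : c 0 = 0 ∧ c 1 = 0 ∧ c 5 = 0) : IsHorizontal γ I := fun s hs => by
  rw [h.vel_eq hI hs, h.vel_eq hI hs, h.vel_eq hI hs]
  exact hc

theorem isExpCurve_of_derivWithin_vel_eq_zero (hI : I.OrdConnected) (hn : I.Nontrivial) (h0 : 0 ∈ I)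
    (h : CurveContDiffOn 2 γ I) (hd : ∀ s ∈ I, ∀ k, derivWithin (vel γ I k) I s = 0) :
    IsExpCurve γ I fun i => vel γ I i 0 := by
  have hU := hI.uniqueDiffOn hn
  refine isExpCurve_of_vel_eq hI hn h0 h two_ne_zero fun s hs i => ?_
  have hdiff : DifferentiableOn ℝ (vel γ I i) I :=
    (h.contDiffOn_vel (m := 1) hU (by norm_num) i).differentiableOn one_ne_zero
  exact hI.convex.is_const_of_fderivWithin_eq_zero (𝕜 := ℝ) hdiff
    (fun t ht => by
      ext1
      exact hd t ht i) hs h0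

theorem IsAutoparallel.isExpCurve (h : IsAutoparallel γ I) (hI : I.OrdConnected) (hn : I.Nontrivial)
    (h0 : 0 ∈ I) : IsExpCurve γ I fun i => vel γ I i 0 := by
  refine isExpCurve_of_derivWithin_vel_eq_zero hI hn h0 h.1 fun s hs k => ?_
  have h1 := congrArg (coframe (γ s) k) (h.2 s hs)
  rwa [cartan_velocity, coframe_sum_frame, if_pos (Finset.mem_univ k), map_zero] at h1

theorem IsBarAutoparallel.isExpCurve (h : IsBarAutoparallel γ I) (hI : I.OrdConnected)
    (hn : I.Nontrivial) (h0 : 0 ∈ I) : IsExpCurve γ I fun i => vel γ I i 0 := by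
  refine isExpCurve_of_derivWithin_vel_eq_zero hI hn h0 h.1 fun s hs k => ?_
  by_cases hk : k ∈ horiz
  · have h1 := congrArg (coframe (γ s) k) (h.2.2 s hs)
    rwa [cartanBar_velocity, coframe_sum_frame, if_pos hk, map_zero] at h1
  -- `cartanBar` carries no information on these three components; horizontality makes them
  -- constant.
  · have h1 : ∀ t ∈ I, vel γ I k t = 0 := by
      intro t ht
      obtain ⟨a, b, c⟩ := h.2.1 t ht
      fin_cases k
      · exact a
      · exact b
      · exact absurd (by decide) hk
      · exact absurd (by decide) hk
      · exact absurd (by decide) hk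
      · exact c
    rw [derivWithin_congr h1 (h1 s hs)]
    exact congrFun (derivWithin_const I (0 : ℝ)) s

theorem sum_mulVec_sq (g : SE3) (v : Fin 3 → ℝ) : ∑ i, (g.R *ᵥ v) i ^ 2 = ∑ i, v i ^ 2 := by
  have h : (g.R *ᵥ v) ⬝ᵥ (g.R *ᵥ v) = v ⬝ᵥ v := by
    rw [Matrix.dotProduct_mulVec, Matrix.vecMul_mulVec, ← Matrix.mulVec_transpose,
      Matrix.transpose_mul, Matrix.transpose_transpose, g.orth, Matrix.one_mulVec]
  simpa only [dotProduct, ← sq] using h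

/-- Here `ẋ = R (c¹, c², c³)` with `R` orthogonal, so the spatial speed is the same at every point.
-/
theorem IsExpCurve.sum_derivWithin_sq (h : IsExpCurve γ I c) (hI : UniqueDiffOn ℝ I) {s : ℝ}
    (hs : s ∈ I) :
    ∑ i, derivWithin (fun t => (γ t).x i) I s ^ 2 = c 0 ^ 2 + c 1 ^ 2 + c 2 ^ 2 := by
  have h1 : ∀ i, derivWithin (fun t => (γ t).x i) I s = ((γ s).R *ᵥ ![c 0, c 1, c 2]) i := by
    intro i
    have h2 := hasDerivWithinAt_mat_iff.mp (h.hasDerivWithinAt hs) (.inl i) (.inr 0)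
    rw [Matrix.mul_apply, Fintype.sum_sum_type, Fin.sum_univ_one] at h2
    refine (HasDerivWithinAt.derivWithin h2 (hI s hs)).trans ?_
    exact add_eq_left.mpr (mul_zero _)
  simp only [h1]
  rw [sum_mulVec_sq, Fin.sum_univ_three]
  rfl

theorem IsExpCurve.isSpatialArcLength_iff (h : IsExpCurve γ I c) (hI : UniqueDiffOn ℝ I)
    (h0 : 0 ∈ I) : IsSpatialArcLength γ I ↔ c 0 ^ 2 + c 1 ^ 2 + c 2 ^ 2 = 1 :=
  ⟨fun h1 => (h.sum_derivWithin_sq hI h0).symm.trans (h1 0 h0),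
    fun h1 _ hs => (h.sum_derivWithin_sq hI hs).trans h1⟩

end Interval

/-- Autoparallel curves and exponential curves. -/
theorem autoparallel_characterization {I : Set ℝ} (hI : I.OrdConnected) (hn : I.Nontrivial)
    (h0 : 0 ∈ I) (γ : ℝ → SE3) :
    (IsAutoparallel γ I ↔ ∃ c, IsExpCurve γ I c) ∧
    (IsAutoparallel γ I ∧ IsSpatialArcLength γ I ↔
      ∃ c, c 0 ^ 2 + c 1 ^ 2 + c 2 ^ 2 = 1 ∧ IsExpCurve γ I c) ∧
    (IsAutoparallel γ I ∧ IsSpatialArcLength γ I ∧ (∀ s ∈ I, vel γ I 5 s = 0) ↔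
      ∃ c, c 5 = 0 ∧ c 0 ^ 2 + c 1 ^ 2 + c 2 ^ 2 = 1 ∧ IsExpCurve γ I c) ∧
    (IsBarAutoparallel γ I ↔ IsHorizontal γ I ∧ ∃ c, IsExpCurve γ I c) ∧
    (IsBarAutoparallel γ I ↔ ∃ c, (c 0 = 0 ∧ c 1 = 0 ∧ c 5 = 0) ∧ IsExpCurve γ I c) ∧
    (IsBarAutoparallel γ I ∧ IsSpatialArcLength γ I ↔
      ∃ c, (c 0 = 0 ∧ c 1 = 0 ∧ c 5 = 0) ∧ c 2 ^ 2 = 1 ∧ IsExpCurve γ I c) := by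
  have hU := hI.uniqueDiffOn hn
  refine ⟨⟨fun h => ⟨_, h.isExpCurve hI hn h0⟩, fun ⟨c, h⟩ => h.isAutoparallel hU⟩,
    ⟨fun ⟨h, h1⟩ => ?_, fun ⟨c, hc, h⟩ => ?_⟩, ⟨fun ⟨h, h1, h2⟩ => ?_, fun ⟨c, h5, hc, h⟩ => ?_⟩,
    ⟨fun h => ⟨h.2.1, _, h.isExpCurve hI hn h0⟩, fun ⟨h, c, hc⟩ => hc.isBarAutoparallel hU h⟩,
    ⟨fun h => ⟨_, h.2.1 0 h0, h.isExpCurve hI hn h0⟩,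
      fun ⟨c, hc, h⟩ => h.isBarAutoparallel hU (h.isHorizontal hU hc)⟩,
    ⟨fun ⟨h, h1⟩ => ?_, fun ⟨c, hc, h2, h⟩ => ?_⟩⟩
  · have he := h.isExpCurve hI hn h0
    exact ⟨_, (he.isSpatialArcLength_iff hU h0).mp h1, he⟩
  · exact ⟨h.isAutoparallel hU, (h.isSpatialArcLength_iff hU h0).mpr hc⟩
  · have he := h.isExpCurve hI hn h0
    exact ⟨_, h2 0 h0, (he.isSpatialArcLength_iff hU h0).mp h1, he⟩
  · exact ⟨h.isAutoparallel hU, (h.isSpatialArcLength_iff hU h0).mpr hc,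
      fun s hs => (h.vel_eq hU hs 5).trans h5⟩
  · have he := h.isExpCurve hI hn h0
    have h2 := (he.isSpatialArcLength_iff hU h0).mp h1
    obtain ⟨h3, h4, -⟩ := h.2.1 0 h0
    refine ⟨_, h.2.1 0 h0, ?_, he⟩
    simpa only [h3, h4, zero_pow two_ne_zero, zero_add] using h2
  · refine ⟨h.isBarAutoparallel hU (h.isHorizontal hU hc), (h.isSpatialArcLength_iff hU h0).mpr ?_⟩
    rw [hc.1, hc.2.1, h2]
    norm_num

/-! ### The dual connection in components. -/

theorem covector_frame (γ : ℝ → SE3) (lam : ℝ → Fin 6 → ℝ) (s : ℝ) (k : Fin 6) :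
    covector γ lam s (frame (γ s) k) = lam s k := by
  simp [covector, LinearMap.sum_apply, coframe_frame]

/-- Contracting with `v` turns the structure constants into the matrix commutator, so they are never
computed one by one. -/
theorem sum_structConst_mul (v : Fin 6 → ℝ) (j k : Fin 6) :
    ∑ i, structConst i j k * v i = coord k (lieElt v * A j - A j * lieElt v) := by
  rw [lieElt_eq_sum, Finset.sum_mul, Finset.mul_sum, ← Finset.sum_sub_distrib, map_sum]
  refine Finset.sum_congr rfl fun i _ => ?_
  rw [structConst, Ring.lie_def, smul_mul_assoc, mul_smul_comm, ← smul_sub, map_smul, smul_eq_mul,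
    mul_comm]

/-- For horizontal `v` the terms left out of the sum are zero, so the restricted connection form
acts as the full `ad`. -/
theorem sum_horiz_structConst {v : Fin 6 → ℝ} (hv : v 0 = 0 ∧ v 1 = 0 ∧ v 5 = 0) (l : Fin 6 → ℝ)
    (j : Fin 6) :
    ∑ i ∈ horiz, ∑ k, structConst i j k * v i * l k =
      ∑ k, l k * coord k (lieElt v * A j - A j * lieElt v) := by
  rw [Finset.sum_comm]
  refine Finset.sum_congr rfl fun k _ => ?_
  rw [← Finset.sum_mul, ← sum_structConst_mul, mul_comm]
  congr 1
  refine Finset.sum_subset (Finset.subset_univ _) fun i _ hi => ?_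
  obtain ⟨h0, h1, h5⟩ := hv
  suffices v i = 0 by rw [this, mul_zero]
  fin_cases i
  · exact h0
  · exact h1
  · exact absurd (by decide) hi
  · exact absurd (by decide) hi
  · exact absurd (by decide) hi
  · exact h5

/-- Covariant constancy of the momentum along a horizontal curve, in components. -/
theorem cartanBarDual_covector_eq_zero {γ : ℝ → SE3} {I : Set ℝ} {lam : ℝ → Fin 6 → ℝ} {s : ℝ}
    (hγ : vel γ I 0 s = 0 ∧ vel γ I 1 s = 0 ∧ vel γ I 5 s = 0)
    (h : ∀ j, derivWithin (fun t => lam t j) I s = ∑ k, lam s k *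
      coord k ((lieElt fun i => vel γ I i s) * A j - A j * lieElt fun i => vel γ I i s)) :
    cartanBarDual γ I (covector γ lam) s = 0 := by
  refine Finset.sum_eq_zero fun j _ => ?_
  simp only [covector_frame]
  rw [h j, sum_horiz_structConst (v := fun i => vel γ I i s) hγ, sub_self, zero_smul]

/-! ### Stationary curves in the extended manifold. -/

section Stationary

attribute [local instance] Matrix.linftyOpNormedRing Matrix.linftyOpNormedAlgebra

open Set

variable {β ℓ ε : ℝ} {Γ : ℝ → ExtPoint}

theorem contDiffOn_slice {f : ℝ → ℝ} {s : Set ℝ} (hε : 0 < ε)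
    (h : ContDiffOn ℝ 2 (fun p : ℝ × ℝ => f p.2) (Ioo (-ε) ε ×ˢ s)) : ContDiffOn ℝ 2 f s :=
  h.comp (f := fun r : ℝ => ((0 : ℝ), r)) (by fun_prop) fun _ hr => ⟨⟨by linarith, hε⟩, hr⟩

/-- The part of `ψ` that does not depend on the velocity. -/
noncomputable def psiStatic (β : ℝ) (p : ExtPoint) : ℝ :=
  √(p.κ₁ ^ 2 + p.κ₂ ^ 2 + β ^ 2) * p.σ - ∑ i, p.lam i * (p.σ * ![0, 0, 1, -p.κ₂, p.κ₁, 0] i)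

/-- A perturbation of the curve in `SE(3)` alone affects only the second summand. -/
theorem psi_eq_psiStatic_add (I : Set ℝ) (r : ℝ) :
    psi β Γ I r = psiStatic β (Γ r) + ∑ i, (Γ r).lam i * vel (fun t => (Γ t).g) I i r := by
  simp only [psi, psiStatic, pfaff, mul_sub, Finset.sum_sub_distrib]
  ring

/-- The curve `Γ` is of class `C²`. -/
structure ExtContDiffOn (Γ : ℝ → ExtPoint) (I : Set ℝ) : Prop where
  g : CurveContDiffOn 2 (fun r => (Γ r).g) I
  κ₁ : ContDiffOn ℝ 2 (fun r => (Γ r).κ₁) I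
  κ₂ : ContDiffOn ℝ 2 (fun r => (Γ r).κ₂) I
  σ : ContDiffOn ℝ 2 (fun r => (Γ r).σ) I
  lam : ∀ i, ContDiffOn ℝ 2 (fun r => (Γ r).lam i) I

theorem IsVariation.extContDiffOn (h : IsVariation ℓ ε Γ fun _ => Γ) (hε : 0 < ε) :
    ExtContDiffOn Γ (Icc 0 ℓ) :=
  ⟨fun i j => contDiffOn_slice hε (h.smooth_g i j), contDiffOn_slice hε h.smooth_κ₁,
    contDiffOn_slice hε h.smooth_κ₂, contDiffOn_slice hε h.smooth_σ,
    fun i => contDiffOn_slice hε (h.smooth_lam i)⟩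

theorem ExtContDiffOn.continuousOn_frameCoeff {I : Set ℝ} (h : ExtContDiffOn Γ I) (i : Fin 6) :
    ContinuousOn (fun r => (Γ r).σ * ![0, 0, 1, -(Γ r).κ₂, (Γ r).κ₁, 0] i) I := by
  refine h.σ.continuousOn.mul ?_
  fin_cases i
  · exact continuousOn_const
  · exact continuousOn_const
  · exact continuousOn_const
  · exact h.κ₂.continuousOn.neg
  · exact h.κ₁.continuousOn
  · exact continuousOn_const

theorem ExtContDiffOn.continuousOn_psiStatic {I : Set ℝ} (h : ExtContDiffOn Γ I) :
    ContinuousOn (fun r => psiStatic β (Γ r)) I := by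
  refine ContinuousOn.sub (ContinuousOn.mul ?_ h.σ.continuousOn) (continuousOn_finsetSum _
    fun i _ => (h.lam i).continuousOn.mul (h.continuousOn_frameCoeff i))
  exact (((h.κ₁.continuousOn.pow 2).add (h.κ₂.continuousOn.pow 2)).add continuousOn_const).sqrt

theorem ExtContDiffOn.continuousOn_vel {I : Set ℝ} (h : ExtContDiffOn Γ I) (hI : UniqueDiffOn ℝ I)
    (i : Fin 6) : ContinuousOn (vel (fun t => (Γ t).g) I i) I :=
  (h.g.contDiffOn_vel (m := 1) hI (by norm_num) i).continuousOn

theorem ExtContDiffOn.continuousOn_pfaff {I : Set ℝ} (h : ExtContDiffOn Γ I)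
    (hI : UniqueDiffOn ℝ I) (i : Fin 6) : ContinuousOn (pfaff Γ I i) I :=
  (h.continuousOn_vel hI i).sub (h.continuousOn_frameCoeff i)

/-- The perturbation of the `i`-th multiplier by `τ φ`. -/
noncomputable def lamVariation (Γ : ℝ → ExtPoint) (φ : ℝ → ℝ) (i : Fin 6) (τ r : ℝ) : ExtPoint :=
  { Γ r with lam := fun k => (Γ r).lam k + τ * (φ r * (Pi.single i 1 : Fin 6 → ℝ) k) }

/-- The perturbation of the curve in `SE(3)` by `Exp (τ φ Aᵢ)`. -/
noncomputable def gVariation (Γ : ℝ → ExtPoint) (φ : ℝ → ℝ) (i : Fin 6) (τ r : ℝ) : ExtPoint :=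
  { Γ r with g := (Γ r).g * Exp ((τ * φ r) • Pi.single i 1) }

/-- The end-point conditions concern only the part in `SE(3)`, so `φ` need not vanish at the ends.
-/
theorem IsVariation.lamVariation (h : IsVariation ℓ ε Γ fun _ => Γ) {φ : ℝ → ℝ}
    (hφ : ContDiff ℝ ∞ φ) (i : Fin 6) : IsVariation ℓ ε Γ (lamVariation Γ φ i) where
  base r _ := by simp [SE3.lamVariation]
  smooth_g := h.smooth_g
  smooth_κ₁ := h.smooth_κ₁
  smooth_κ₂ := h.smooth_κ₂
  smooth_σ := h.smooth_σ
  smooth_lam k := by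
    have hφ2 : ContDiff ℝ 2 φ := contDiff_infty.mp hφ 2
    exact (h.smooth_lam k).add (contDiff_fst.mul ((hφ2.comp contDiff_snd).mul
      contDiff_const)).contDiffOn
  σ_pos := h.σ_pos
  left := h.left
  right := h.right

theorem Exp_zero : Exp 0 = 1 := toMat_injective (by rw [toMat_Exp]; simp [toMat_one])

theorem IsVariation.gVariation (h : IsVariation ℓ ε Γ fun _ => Γ) {φ : ℝ → ℝ}
    (hφ : ContDiff ℝ ∞ φ) (h0 : φ 0 = 0) (h1 : φ ℓ = 0) (i : Fin 6) :
    IsVariation ℓ ε Γ (gVariation Γ φ i) where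
  base r _ := by
    simp [SE3.gVariation, Exp_zero]
  smooth_g a b := by
    have hφ2 : ContDiff ℝ 2 φ := contDiff_infty.mp hφ 2
    simp only [SE3.gVariation, toMat_mul, toMat_Exp_smul, Matrix.mul_apply]
    refine ContDiffOn.sum fun l _ => (h.smooth_g a l).mul ?_
    exact ((contDiff_exp_smul (lieElt (Pi.single i 1)) l b).comp
      (contDiff_fst.mul (hφ2.comp contDiff_snd))).contDiffOn
  smooth_κ₁ := h.smooth_κ₁
  smooth_κ₂ := h.smooth_κ₂
  smooth_σ := h.smooth_σ
  smooth_lam := h.smooth_lam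
  σ_pos := h.σ_pos
  left τ _ := by
    simp [SE3.gVariation, Exp_zero, h0]
  right τ _ := by
    simp [SE3.gVariation, Exp_zero, h1]

/-- The integral is affine in `τ` under a perturbation of the `i`-th multiplier, with slope `∫ φ
θⁱ`; the multipliers enforce their constraints. -/
theorem IsStationaryExt.pfaff_eq_zero (hℓ : 0 < ℓ) (h : IsStationaryExt β ℓ Γ) (i : Fin 6) :
    ∀ r ∈ Icc 0 ℓ, pfaff Γ (Icc 0 ℓ) i r = 0 := by
  obtain ⟨⟨ε, hε, hv⟩, hst⟩ := h
  have hU := uniqueDiffOn_Icc hℓ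
  have hc := hv.extContDiffOn hε
  have hp := hc.continuousOn_pfaff hU i
  refine eqOn_zero_of_integral_contDiff_mul_eq_zero hℓ hp fun φ hφ _ => ?_
  have h1 := hst ε _ hε (hv.lamVariation hφ i)
  have h2 : ∀ τ r, psi β (lamVariation Γ φ i τ) (Icc 0 ℓ) r =
      psi β Γ (Icc 0 ℓ) r + τ * (φ r * pfaff Γ (Icc 0 ℓ) i r) := by
    intro τ r
    have h3 : ∀ k, pfaff (lamVariation Γ φ i τ) (Icc 0 ℓ) k r = pfaff Γ (Icc 0 ℓ) k r :=
      fun k => rfl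
    simp only [psi, h3, lamVariation, add_mul, Finset.sum_add_distrib, Pi.single_apply]
    simp
    ring
  simp only [h2] at h1
  have hpsi : ContinuousOn (psi β Γ (Icc 0 ℓ)) (Icc 0 ℓ) := by
    simp only [funext fun r => psi_eq_psiStatic_add (β := β) (Γ := Γ) (Icc 0 ℓ) r]
    exact hc.continuousOn_psiStatic.add (continuousOn_finsetSum _ fun k _ =>
      (hc.lam k).continuousOn.mul (hc.continuousOn_vel hU k))
  have hφp : ContinuousOn (fun r => φ r * pfaff Γ (Icc 0 ℓ) i r) (Icc 0 ℓ) :=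
    hφ.continuous.continuousOn.mul hp
  refine (hasDerivAt_integral_of_continuousOn_deriv (ε := 1) one_pos hℓ.le
    (F' := fun _ r => φ r * pfaff Γ (Icc 0 ℓ) i r) ?_ ?_ ?_).unique h1
  · exact fun τ _ => hpsi.add (continuousOn_const.mul hφp)
  · exact hφp.comp continuousOn_snd fun p hp => hp.2
  · intro τ _ r _
    simpa using ((hasDerivAt_id τ).mul_const (φ r * pfaff Γ (Icc 0 ℓ) i r)).const_add
      (psi β Γ (Icc 0 ℓ) r)

theorem toMat_Exp_smul_inv (t : ℝ) (c : Fin 6 → ℝ) :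
    (Exp (t • c))⁻¹.toMat = NormedSpace.exp (-(t • lieElt c)) := by
  refine left_inv_eq_right_inv (toMat_inv_mul_self _) ?_
  rw [toMat_Exp_smul]
  exact mul_eq_one_comm.mp (exp_smul_neg_mul_exp_smul _ _)

/-- Logarithmic derivative of a product: `(gE)⁻¹ (gE)' = E⁻¹ X E + E⁻¹ E'`. For `E = exp(τ φ Aᵢ)`
the last term is exactly `τ φ' Aᵢ`, because `E' = τ φ' E Aᵢ`. -/
theorem vel_gVariation {I : Set ℝ} {r : ℝ} (hg : CurveContDiffOn 2 (fun t => (Γ t).g) I)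
    (hr : r ∈ I) (hI : UniqueDiffWithinAt ℝ I r) {φ : ℝ → ℝ} {φ' : ℝ} (hφ : HasDerivAt φ φ' r)
    (i k : Fin 6) (τ : ℝ) :
    vel (fun t => (gVariation Γ φ i τ t).g) I k r =
      coord k (NormedSpace.exp (-((τ * φ r) • A i)) *
        (lieElt fun j => vel (fun t => (Γ t).g) I j r) * NormedSpace.exp ((τ * φ r) • A i) +
        (τ * φ') • A i) := by
  set X := lieElt fun j => vel (fun t => (Γ t).g) I j r
  set E := NormedSpace.exp ((τ * φ r) • A i) with hE
  have h1 : HasDerivWithinAt (fun t => (Γ t).g.toMat) ((Γ r).g.toMat * X) I r :=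
    hg.hasDerivWithinAt_lieElt two_ne_zero hr hI
  have h2 : HasDerivWithinAt (fun t => NormedSpace.exp ((τ * φ t) • A i))
      ((τ * φ') • (E * A i)) I r :=
    (HasDerivAt.scomp (g₁ := fun u : ℝ => NormedSpace.exp (u • A i)) r
      (hasDerivAt_exp_smul (A i) (τ * φ r)) (hφ.const_mul τ)).hasDerivWithinAt
  have h3 : HasDerivWithinAt (fun t => (gVariation Γ φ i τ t).g.toMat)
      ((Γ r).g.toMat * X * E + (Γ r).g.toMat * ((τ * φ') • (E * A i))) I r := by
    simp only [gVariation, toMat_mul, toMat_Exp_smul]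
    exact h1.mul h2
  have h4 : (gVariation Γ φ i τ r).g⁻¹.toMat =
      NormedSpace.exp (-((τ * φ r) • A i)) * (Γ r).g⁻¹.toMat := by
    rw [gVariation, mul_inv_rev, toMat_mul, toMat_Exp_smul_inv]
    rfl
  rw [vel, velocity_eq h3 hI, coframe, LinearMap.comp_apply, LinearMap.mulLeft_apply, h4]
  congr 1
  have h5 : (Γ r).g⁻¹.toMat * ((Γ r).g.toMat * X * E + (Γ r).g.toMat * ((τ * φ') • (E * A i))) =
      X * E + (τ * φ') • (E * A i) := by
    rw [Matrix.mul_add, ← Matrix.mul_assoc, ← Matrix.mul_assoc, ← Matrix.mul_assoc,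
      toMat_inv_mul_self, Matrix.one_mul, Matrix.one_mul]
  rw [Matrix.mul_assoc, h5, Matrix.mul_add, Matrix.mul_smul, ← Matrix.mul_assoc,
    ← Matrix.mul_assoc, exp_smul_neg_mul_exp_smul, Matrix.one_mul]

/-- The derivative of the adjoint action is the bracket; it is needed for all `t`, since
differentiating under the integral requires the derivative on a neighbourhood of `0`. -/
theorem hasDerivAt_conj_exp (X Y : Mat4) (t : ℝ) :
    HasDerivAt (fun u : ℝ => NormedSpace.exp (-(u • Y)) * X * NormedSpace.exp (u • Y))
      (NormedSpace.exp (-(t • Y)) * (X * Y - Y * X) * NormedSpace.exp (t • Y)) t := by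
  have h1 : HasDerivAt (fun u : ℝ => NormedSpace.exp (-(u • Y)))
      (NormedSpace.exp (-(t • Y)) * -Y) t := by
    simpa only [smul_neg] using hasDerivAt_exp_smul (-Y) t
  have h2 : HasDerivAt (fun u : ℝ => NormedSpace.exp (u • Y)) (Y * NormedSpace.exp (t • Y)) t :=
    hasDerivAt_exp_smul_const' Y t
  have h3 := (h1.mul_const X).mul h2
  have h4 : NormedSpace.exp (-(t • Y)) * (X * Y - Y * X) * NormedSpace.exp (t • Y) =
      NormedSpace.exp (-(t • Y)) * -Y * X * NormedSpace.exp (t • Y) +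
        NormedSpace.exp (-(t • Y)) * X * (Y * NormedSpace.exp (t • Y)) := by
    noncomm_ring
  rw [h4]
  exact h3

theorem continuous_exp_smul (X : Mat4) : Continuous fun t : ℝ => NormedSpace.exp (t • X) :=
  (contDiff_exp_smul_const (n := 0) X).continuous

/-- The Euler-Lagrange equation in the direction `𝒜ᵢ`. -/
theorem IsStationaryExt.derivWithin_lam (hℓ : 0 < ℓ) (h : IsStationaryExt β ℓ Γ) (i : Fin 6)
    {r : ℝ} (hr : r ∈ Icc 0 ℓ) :
    derivWithin (fun t => (Γ t).lam i) (Icc 0 ℓ) r = ∑ k, (Γ r).lam k *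
      coord k ((lieElt fun j => vel (fun t => (Γ t).g) (Icc 0 ℓ) j r) * A i -
        A i * lieElt fun j => vel (fun t => (Γ t).g) (Icc 0 ℓ) j r) := by
  obtain ⟨⟨ε, hε, hv⟩, hst⟩ := h
  have hU := uniqueDiffOn_Icc hℓ
  have hc := hv.extContDiffOn hε
  set X : ℝ → Mat4 := fun r => lieElt fun j => vel (fun t => (Γ t).g) (Icc 0 ℓ) j r with hX
  have hXc : ContinuousOn X (Icc 0 ℓ) := by
    simp only [hX, lieElt_eq_sum]
    exact continuousOn_finsetSum _ fun k _ => (hc.continuousOn_vel hU k).smul continuousOn_const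
  have hcoord : ∀ k, Continuous (coord k) := fun k => LinearMap.continuous_of_finiteDimensional _
  set S : ℝ → ℝ := fun r => ∑ k, (Γ r).lam k * coord k (X r * A i - A i * X r) with hS
  have hSc : ContinuousOn S (Icc 0 ℓ) := continuousOn_finsetSum _ fun k _ =>
    (hc.lam k).continuousOn.mul ((hcoord k).comp_continuousOn
      ((hXc.mul continuousOn_const).sub (continuousOn_const.mul hXc)))
  have hlc : ContinuousOn (derivWithin (fun t => (Γ t).lam i) (Icc 0 ℓ)) (Icc 0 ℓ) :=
    (hc.lam i).continuousOn_derivWithin hU (by norm_num)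
  suffices H : ∀ r ∈ Icc 0 ℓ, S r - derivWithin (fun t => (Γ t).lam i) (Icc 0 ℓ) r = 0 from
    (sub_eq_zero.mp (H r hr)).symm
  refine eqOn_zero_of_integral_contDiff_mul_eq_zero hℓ (hSc.sub hlc) fun φ hφ hsupp => ?_
  have hφ0 := eq_zero_left_of_tsupport_subset_Ioo hsupp
  have hφ1 := eq_zero_right_of_tsupport_subset_Ioo hsupp
  have hφd : ∀ r, HasDerivAt φ (deriv φ r) r := fun r =>
    (hφ.differentiable (by simp) r).hasDerivAt
  have hφc : Continuous (deriv φ) := hφ.continuous_deriv (by simp)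
  have h1 := hst ε _ hε (hv.gVariation hφ hφ0 hφ1 i)
  set F : ℝ → ℝ → ℝ := fun τ r => psiStatic β (Γ r) + ∑ k, (Γ r).lam k *
    coord k (NormedSpace.exp (-((τ * φ r) • A i)) * X r * NormedSpace.exp ((τ * φ r) • A i) +
        (τ * deriv φ r) • A i)
  set F' : ℝ → ℝ → ℝ := fun τ r => ∑ k, (Γ r).lam k *
    coord k (φ r • (NormedSpace.exp (-((τ * φ r) • A i)) * (X r * A i - A i * X r) *
      NormedSpace.exp ((τ * φ r) • A i)) + deriv φ r • A i)
  have h2 : ∀ τ, ∫ r in (0 : ℝ)..ℓ, psi β (gVariation Γ φ i τ) (Icc 0 ℓ) r =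
      ∫ r in (0 : ℝ)..ℓ, F τ r := by
    intro τ
    refine intervalIntegral.integral_congr fun r hr => ?_
    rw [uIcc_of_le hℓ.le] at hr
    simp only [psi_eq_psiStatic_add, vel_gVariation hc.g hr (hU r hr) (hφd r)]
    rfl
  simp only [h2] at h1
  have hexp := continuous_exp_smul (A i)
  have hexp' : Continuous fun t : ℝ => NormedSpace.exp (-(t • A i)) := by
    simpa only [smul_neg] using continuous_exp_smul (-A i)
  have hF' : ∫ r in (0 : ℝ)..ℓ, F' 0 r = 0 := by
    refine (hasDerivAt_integral_of_continuousOn_deriv (ε := 1) one_pos hℓ.le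
      (F := F) (F' := F') ?_ ?_ ?_).unique h1
    · intro τ _
      have hτ : Continuous fun r => τ * φ r := continuous_const.mul hφ.continuous
      refine hc.continuousOn_psiStatic.add (continuousOn_finsetSum _ fun k _ =>
        (hc.lam k).continuousOn.mul ((hcoord k).comp_continuousOn (ContinuousOn.add ?_ ?_)))
      · exact ((hexp'.comp hτ).continuousOn.mul hXc).mul (hexp.comp hτ).continuousOn
      · exact ((continuous_const.mul hφc).smul continuous_const).continuousOn
    · have hτ : Continuous fun p : ℝ × ℝ => p.1 * φ p.2 :=
        continuous_fst.mul (hφ.continuous.comp continuous_snd)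
      have hs : MapsTo (Prod.snd : ℝ × ℝ → ℝ) (Icc (-1) 1 ×ˢ Icc 0 ℓ) (Icc 0 ℓ) := fun p hp => hp.2
      have hX2 := hXc.comp continuousOn_snd hs
      refine continuousOn_finsetSum _ fun k _ => ((hc.lam k).continuousOn.comp continuousOn_snd hs).mul
        ((hcoord k).comp_continuousOn (ContinuousOn.add ?_ ?_))
      · refine (hφ.continuous.comp continuous_snd).continuousOn.smul ?_
        exact ((hexp'.comp hτ).continuousOn.mul ((hX2.mul continuousOn_const).sub
          (continuousOn_const.mul hX2))).mul (hexp.comp hτ).continuousOn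
      · exact ((hφc.comp continuous_snd).smul continuous_const).continuousOn
    · intro τ _ r _
      refine (HasDerivAt.fun_sum fun k _ => HasDerivAt.const_mul _ ?_).const_add _
      have h3 : HasDerivAt (fun τ : ℝ => NormedSpace.exp (-((τ * φ r) • A i)) * X r *
          NormedSpace.exp ((τ * φ r) • A i) + (τ * deriv φ r) • A i)
          (φ r • (NormedSpace.exp (-((τ * φ r) • A i)) * (X r * A i - A i * X r) *
            NormedSpace.exp ((τ * φ r) • A i)) + deriv φ r • A i) τ :=
        (HasDerivAt.scomp (g₁ := fun u : ℝ => NormedSpace.exp (-(u • A i)) * X r *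
          NormedSpace.exp (u • A i)) τ (hasDerivAt_conj_exp (X r) (A i) (τ * φ r))
          (by simpa using (hasDerivAt_id τ).mul_const (φ r))).add
          (by simpa using ((hasDerivAt_id τ).mul_const (deriv φ r)).smul_const (A i))
      exact (LinearMap.toContinuousLinearMap (coord k)).hasFDerivAt.comp_hasDerivAt τ h3
  -- At `τ = 0` the exponentials are `1`. What remains is `φ ⟨λ, [X, Aᵢ]⟩ + λᵢ φ'`, and the second
  -- term is then integrated by parts.
  have h4 : ∀ r, F' 0 r = φ r * S r + (Γ r).lam i * deriv φ r := by
    intro r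
    simp only [F', hS, zero_mul, zero_smul, neg_zero, NormedSpace.exp_zero, one_mul, mul_one, map_add,
      map_smul, coord_A, smul_eq_mul, mul_add, Finset.sum_add_distrib, Finset.mul_sum]
    congr 1
    · exact Finset.sum_congr rfl fun k _ => by ring
    · simp
  have hicc : ∀ {f : ℝ → ℝ}, ContinuousOn f (Icc 0 ℓ) →
      IntervalIntegrable f MeasureTheory.volume 0 ℓ := fun hf =>
    ContinuousOn.intervalIntegrable (by rwa [uIcc_of_le hℓ.le])
  have h5 := integral_mul_deriv_of_eq_zero hℓ.le
    (fun r hr => ((hc.lam i).differentiableOn two_ne_zero r hr).hasDerivWithinAt) hlc hφd hφc hφ0 hφ1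
  have h6 : ContinuousOn (fun r => φ r * S r) (Icc 0 ℓ) := hφ.continuous.continuousOn.mul hSc
  have h7 : ContinuousOn (fun r => (Γ r).lam i * deriv φ r) (Icc 0 ℓ) :=
    (hc.lam i).continuousOn.mul hφc.continuousOn
  have h8 : ContinuousOn
      (fun r => φ r * derivWithin (fun t => (Γ t).lam i) (Icc 0 ℓ) r) (Icc 0 ℓ) :=
    hφ.continuous.continuousOn.mul hlc
  simp only [h4] at hF'
  rw [intervalIntegral.integral_add (hicc h6) (hicc h7), h5] at hF'
  simp only [mul_sub]
  rw [intervalIntegral.integral_sub (hicc h6) (hicc h8)]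
  linarith

/-- Stationary curves in the extended manifold are horizontal with covariantly constant momentum. -/
theorem IsStationaryExt.isHorizontal_and_cartanBarDual_eq_zero (hℓ : 0 < ℓ)
    (h : IsStationaryExt β ℓ Γ) :
    IsHorizontal (fun r => (Γ r).g) (Icc 0 ℓ) ∧
      ∀ r ∈ Icc 0 ℓ, cartanBarDual (fun r => (Γ r).g) (Icc 0 ℓ)
        (covector (fun r => (Γ r).g) fun r => (Γ r).lam) r = 0 := by
  have hH : IsHorizontal (fun r => (Γ r).g) (Icc 0 ℓ) := by
    intro r hr
    refine ⟨?_, ?_, ?_⟩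
    · simpa [pfaff] using h.pfaff_eq_zero hℓ 0 r hr
    · simpa [pfaff] using h.pfaff_eq_zero hℓ 1 r hr
    · simpa [pfaff] using h.pfaff_eq_zero hℓ 5 r hr
  exact ⟨hH, fun r hr => cartanBarDual_covector_eq_zero (hH r hr) fun j => h.derivWithin_lam hℓ j hr⟩

end Stationary

/-! ### First variation of the energy of a space curve. -/

section Energy

open Set

variable {β L : ℝ}

/-- The first radicand is at least `β² > 0`, so the integrand stays differentiable where the
curvature vanishes. -/
theorem hasDerivAt_sqrt_mul_sqrt (hβ : 0 < β) {q C : ℝ → ℝ} {q' C' h : ℝ}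
    (hq : HasDerivAt q q' h) (hC : HasDerivAt C C' h) (hq0 : 0 < q h) (hC0 : 0 ≤ C h) :
    HasDerivAt (fun h => √(C h / q h ^ 3 + β ^ 2) * √(q h))
      ((C' * q h ^ 3 - C h * (3 * q h ^ 2 * q')) / (q h ^ 3) ^ 2 /
        (2 * √(C h / q h ^ 3 + β ^ 2)) * √(q h) +
        √(C h / q h ^ 3 + β ^ 2) * (q' / (2 * √(q h)))) h := by
  have h1 : HasDerivAt (fun h => q h ^ 3) (3 * q h ^ 2 * q') h := by simpa using hq.fun_pow 3
  have h2 : 0 < C h / q h ^ 3 + β ^ 2 := by positivity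
  exact (((hC.div h1 (by positivity)).add_const _).sqrt h2.ne').mul (hq.sqrt hq0.ne')

/-- The integrand of the energy in terms of the scalar products of the first two derivatives. -/
theorem energy_integrand {y : ℝ → Fin 3 → ℝ} {p p' : Fin 3 → ℝ} {u : ℝ}
    (hp : derivWithin y (Icc 0 L) u = p)
    (hp' : derivWithin (derivWithin y (Icc 0 L)) (Icc 0 L) u = p') :
    √(curvature L y u ^ 2 + β ^ 2) *
      √(derivWithin y (Icc 0 L) u ⬝ᵥ derivWithin y (Icc 0 L) u) =
    √(((p ⬝ᵥ p) * (p' ⬝ᵥ p') - (p ⬝ᵥ p') ^ 2) / (p ⬝ᵥ p) ^ 3 + β ^ 2) * √(p ⬝ᵥ p) := by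
  -- Lagrange's identity; it frees the integrand of cross products.
  have hC : crossProduct p p' ⬝ᵥ crossProduct p p' =
      (p ⬝ᵥ p) * (p' ⬝ᵥ p') - (p ⬝ᵥ p') ^ 2 := by
    rw [cross_dot_cross, dotProduct_comm p' p, sq]
  have h0 : ∀ v : Fin 3 → ℝ, 0 ≤ v ⬝ᵥ v := fun v =>
    Finset.sum_nonneg fun i _ => mul_self_nonneg _
  have hc : curvature L y u ^ 2 =
      ((p ⬝ᵥ p) * (p' ⬝ᵥ p') - (p ⬝ᵥ p') ^ 2) / (p ⬝ᵥ p) ^ 3 := by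
    simp only [curvature, hp, hp']
    rw [div_pow, Real.sq_sqrt (h0 _), hC, ← pow_mul, mul_comm 3 2, pow_mul, Real.sq_sqrt (h0 _)]
  rw [hc, hp]

/-- The first variation of the energy at a curve with unit tangent `T` and curvature vector `K`. -/
theorem hasDerivAt_energy (hβ : 0 < β) (hL : 0 < L) {x T K : ℝ → Fin 3 → ℝ}
    (hx : ∀ s ∈ Icc 0 L, HasDerivWithinAt x (T s) (Icc 0 L) s)
    (hT : ∀ s ∈ Icc 0 L, HasDerivWithinAt T (K s) (Icc 0 L) s) (hK : ContinuousOn K (Icc 0 L))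
    (hTT : ∀ s ∈ Icc 0 L, T s ⬝ᵥ T s = 1) (hTK : ∀ s ∈ Icc 0 L, T s ⬝ᵥ K s = 0)
    {φ φ₁ φ₂ : ℝ → ℝ} (hφ : ∀ s, HasDerivAt φ (φ₁ s) s) (hφ₁ : ∀ s, HasDerivAt φ₁ (φ₂ s) s)
    (hφ₂ : Continuous φ₂) (v : Fin 3 → ℝ) :
    HasDerivAt (fun h : ℝ => energy β L fun u => x u + h • φ u • v)
      (∫ u in (0 : ℝ)..L, (φ₂ u * (K u ⬝ᵥ v / √(K u ⬝ᵥ K u + β ^ 2)) +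
        φ₁ u * (T u ⬝ᵥ v * ((β ^ 2 - K u ⬝ᵥ K u) / √(K u ⬝ᵥ K u + β ^ 2))))) 0 := by
  have hU := uniqueDiffOn_Icc hL
  have hTc : ContinuousOn T (Icc 0 L) := fun s hs => (hT s hs).continuousWithinAt
  have hφ₁c : Continuous φ₁ := continuous_iff_continuousAt.mpr fun s => (hφ₁ s).continuousAt
  have hdot : ∀ {f g : ℝ → Fin 3 → ℝ}, ContinuousOn f (Icc 0 L) → ContinuousOn g (Icc 0 L) →
      ContinuousOn (fun s => f s ⬝ᵥ g s) (Icc 0 L) := fun hf hg =>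
    continuousOn_finsetSum _ fun i _ =>
      ((continuousOn_pi.mp hf i).mul (continuousOn_pi.mp hg i))
  have hTv := hdot hTc (continuousOn_const (c := v))
  have hKv := hdot hK (continuousOn_const (c := v))
  have hKK := hdot hK hK
  -- scalar products of the first two derivatives of the perturbed curve
  set q : ℝ → ℝ → ℝ := fun h u => 1 + 2 * h * (φ₁ u * (T u ⬝ᵥ v)) + h ^ 2 * (φ₁ u ^ 2 * (v ⬝ᵥ v))
    with hq
  set m : ℝ → ℝ → ℝ := fun h u =>
    K u ⬝ᵥ K u + 2 * h * (φ₂ u * (K u ⬝ᵥ v)) + h ^ 2 * (φ₂ u ^ 2 * (v ⬝ᵥ v)) with hm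
  set n : ℝ → ℝ → ℝ := fun h u =>
    h * (φ₂ u * (T u ⬝ᵥ v) + φ₁ u * (K u ⬝ᵥ v)) + h ^ 2 * (φ₁ u * φ₂ u * (v ⬝ᵥ v)) with hn
  have hqe : ∀ h, ∀ u ∈ Icc 0 L, (T u + (h * φ₁ u) • v) ⬝ᵥ (T u + (h * φ₁ u) • v) = q h u := by
    intro h u hu
    simp only [add_dotProduct, dotProduct_add, smul_dotProduct, dotProduct_smul, smul_eq_mul,
      hTT u hu, dotProduct_comm v (T u), hq]
    ring
  have hme : ∀ h, ∀ u ∈ Icc 0 L, (K u + (h * φ₂ u) • v) ⬝ᵥ (K u + (h * φ₂ u) • v) = m h u := by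
    intro h u hu
    simp only [add_dotProduct, dotProduct_add, smul_dotProduct, dotProduct_smul, smul_eq_mul,
      dotProduct_comm v (K u), hm]
    ring
  have hne : ∀ h, ∀ u ∈ Icc 0 L, (T u + (h * φ₁ u) • v) ⬝ᵥ (K u + (h * φ₂ u) • v) = n h u := by
    intro h u hu
    simp only [add_dotProduct, dotProduct_add, smul_dotProduct, dotProduct_smul, smul_eq_mul,
      hTK u hu, dotProduct_comm v (K u), hn]
    ring
  -- By Lagrange's identity this is the squared length of a cross product.
  have hC0 : ∀ h, ∀ u ∈ Icc 0 L, 0 ≤ q h u * m h u - n h u ^ 2 := by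
    intro h u hu
    have h1 := cross_dot_cross (T u + (h * φ₁ u) • v) (K u + (h * φ₂ u) • v)
      (T u + (h * φ₁ u) • v) (K u + (h * φ₂ u) • v)
    rw [dotProduct_comm (K u + _) (T u + _), hqe h u hu, hme h u hu, hne h u hu] at h1
    rw [sq, ← h1]
    exact Finset.sum_nonneg fun i _ => mul_self_nonneg _
  set F : ℝ → ℝ → ℝ := fun h u => √((q h u * m h u - n h u ^ 2) / q h u ^ 3 + β ^ 2) * √(q h u)
    with hF
  have hE : ∀ h, energy β L (fun u => x u + h • φ u • v) = ∫ u in (0 : ℝ)..L, F h u := by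
    intro h
    have d1 : ∀ u ∈ Icc 0 L, derivWithin (fun u => x u + h • φ u • v) (Icc 0 L) u =
        T u + (h * φ₁ u) • v := by
      intro u hu
      rw [mul_smul]
      exact ((hx u hu).add (((hφ u).hasDerivWithinAt.smul_const v).const_smul h)).derivWithin
        (hU u hu)
    have d2 : ∀ u ∈ Icc 0 L,
        derivWithin (derivWithin (fun u => x u + h • φ u • v) (Icc 0 L)) (Icc 0 L) u =
        K u + (h * φ₂ u) • v := by
      intro u hu
      rw [derivWithin_congr d1 (d1 u hu)]
      exact ((hT u hu).add (((hφ₁ u).hasDerivWithinAt.const_mul h).smul_const v)).derivWithin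
        (hU u hu)
    refine intervalIntegral.integral_congr fun u hu => ?_
    rw [uIcc_of_le hL.le] at hu
    refine (energy_integrand (d1 u hu) (d2 u hu)).trans ?_
    rw [hqe h u hu, hme h u hu, hne h u hu]
  simp only [hE]
  -- `M` bounds the coefficient of `2h` in `q`. For `|h| ≤ 1/(4(M+1))` this gives `q ≥ 1 - 2/4`, so
  -- the perturbed curve stays regular; the `+ 1` covers `M = 0`.
  obtain ⟨M, hM⟩ := isCompact_Icc.exists_bound_of_continuousOn (hφ₁c.continuousOn.mul hTv)
  have hM0 : 0 ≤ M := (norm_nonneg _).trans (hM 0 ⟨le_rfl, hL.le⟩)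
  have hε : 0 < 1 / (4 * (M + 1)) := by positivity
  have hvv : 0 ≤ v ⬝ᵥ v := Finset.sum_nonneg fun i _ => mul_self_nonneg _
  have hq0 : ∀ h ∈ Icc (-(1 / (4 * (M + 1)))) (1 / (4 * (M + 1))), ∀ u ∈ Icc 0 L, 0 < q h u := by
    intro h hh u hu
    have h1 : |h * (φ₁ u * (T u ⬝ᵥ v))| ≤ 1 / (4 * (M + 1)) * M := by
      rw [abs_mul]
      exact mul_le_mul (abs_le.mpr hh) (hM u hu) (abs_nonneg _) hε.le
    have h2 : 1 / (4 * (M + 1)) * M ≤ 1 / 4 := by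
      rw [div_mul_eq_mul_div, div_le_div_iff₀ (by positivity) (by positivity)]
      linarith
    have h3 := neg_le_of_abs_le (h1.trans h2)
    have h4 : 0 ≤ h ^ 2 * (φ₁ u ^ 2 * (v ⬝ᵥ v)) := by positivity
    simp only [hq]
    linarith
  set q' : ℝ → ℝ → ℝ := fun h u => 2 * (φ₁ u * (T u ⬝ᵥ v)) + 2 * h * (φ₁ u ^ 2 * (v ⬝ᵥ v)) with hq'
  set m' : ℝ → ℝ → ℝ := fun h u => 2 * (φ₂ u * (K u ⬝ᵥ v)) + 2 * h * (φ₂ u ^ 2 * (v ⬝ᵥ v)) with hm'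
  set n' : ℝ → ℝ → ℝ := fun h u =>
    (φ₂ u * (T u ⬝ᵥ v) + φ₁ u * (K u ⬝ᵥ v)) + 2 * h * (φ₁ u * φ₂ u * (v ⬝ᵥ v)) with hn'
  have hquad : ∀ a b c h : ℝ, HasDerivAt (fun h => a + 2 * h * b + h ^ 2 * c) (2 * b + 2 * h * c) h := by
    intro a b c h
    have := ((((hasDerivAt_id h).const_mul 2).mul_const b).const_add a).fun_add
      (((hasDerivAt_id h).fun_pow 2).mul_const c)
    simpa using this
  have hdn : ∀ h u, HasDerivAt (fun h => n h u) (n' h u) h := by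
    intro h u
    have := ((hasDerivAt_id h).mul_const (φ₂ u * (T u ⬝ᵥ v) + φ₁ u * (K u ⬝ᵥ v))).fun_add
      (((hasDerivAt_id h).fun_pow 2).mul_const (φ₁ u * φ₂ u * (v ⬝ᵥ v)))
    simpa using this
  set C' : ℝ → ℝ → ℝ := fun h u => q' h u * m h u + q h u * m' h u - 2 * n h u * n' h u with hC'
  have hdC : ∀ h u, HasDerivAt (fun h => q h u * m h u - n h u ^ 2) (C' h u) h := by
    intro h u
    refine (((hquad _ _ _ h).mul (hquad _ _ _ h)).sub ((hdn h u).fun_pow 2)).congr_deriv ?_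
    simp only [hC', hq', hm', hq, hm, Nat.cast_ofNat, Nat.add_one_sub_one, pow_one]
  set F' : ℝ → ℝ → ℝ := fun h u =>
    (C' h u * q h u ^ 3 - (q h u * m h u - n h u ^ 2) * (3 * q h u ^ 2 * q' h u)) /
        (q h u ^ 3) ^ 2 /
        (2 * √((q h u * m h u - n h u ^ 2) / q h u ^ 3 + β ^ 2)) * √(q h u) +
      √((q h u * m h u - n h u ^ 2) / q h u ^ 3 + β ^ 2) * (q' h u / (2 * √(q h u))) with hF'
  have hF'0 : ∫ u in (0 : ℝ)..L, F' 0 u =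
      ∫ u in (0 : ℝ)..L, (φ₂ u * (K u ⬝ᵥ v / √(K u ⬝ᵥ K u + β ^ 2)) +
        φ₁ u * (T u ⬝ᵥ v * ((β ^ 2 - K u ⬝ᵥ K u) / √(K u ⬝ᵥ K u + β ^ 2)))) := by
    refine intervalIntegral.integral_congr fun u hu => ?_
    have hKK0 : 0 ≤ K u ⬝ᵥ K u := Finset.sum_nonneg fun i _ => mul_self_nonneg _
    have hD : 0 < √(K u ⬝ᵥ K u + β ^ 2) := Real.sqrt_pos.mpr (by positivity)
    have hD2 : √(K u ⬝ᵥ K u + β ^ 2) ^ 2 = K u ⬝ᵥ K u + β ^ 2 := Real.sq_sqrt (by positivity)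
    simp only [hF', hC', hq, hm, hn, hq', hm', hn', mul_zero, zero_mul, add_zero, zero_pow two_ne_zero,
      one_pow, mul_one, div_one, one_mul, sub_zero, Real.sqrt_one]
    -- Eliminating `β²` in favour of the squared root leaves an identity that is rational in the
    -- root.
    conv_rhs => rw [show β ^ 2 - K u ⬝ᵥ K u = √(K u ⬝ᵥ K u + β ^ 2) ^ 2 - 2 * (K u ⬝ᵥ K u) by
      rw [hD2]; ring]
    field_simp
    ring
  rw [← hF'0]
  have hs : ∀ S : Set ℝ, MapsTo (Prod.snd : ℝ × ℝ → ℝ) (S ×ˢ Icc 0 L) (Icc 0 L) := fun S p hp => hp.2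
  have hpoly : ∀ S : Set ℝ,
      ContinuousOn (fun p : ℝ × ℝ => q p.1 p.2) (S ×ˢ Icc 0 L) ∧
      ContinuousOn (fun p : ℝ × ℝ => m p.1 p.2) (S ×ˢ Icc 0 L) ∧
      ContinuousOn (fun p : ℝ × ℝ => n p.1 p.2) (S ×ˢ Icc 0 L) ∧
      ContinuousOn (fun p : ℝ × ℝ => q' p.1 p.2) (S ×ˢ Icc 0 L) ∧
      ContinuousOn (fun p : ℝ × ℝ => m' p.1 p.2) (S ×ˢ Icc 0 L) ∧
      ContinuousOn (fun p : ℝ × ℝ => n' p.1 p.2) (S ×ˢ Icc 0 L) := by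
    intro S
    have a1 : ContinuousOn (fun p : ℝ × ℝ => T p.2 ⬝ᵥ v) (S ×ˢ Icc 0 L) :=
      hTv.comp continuousOn_snd (hs S)
    have a2 : ContinuousOn (fun p : ℝ × ℝ => K p.2 ⬝ᵥ v) (S ×ˢ Icc 0 L) :=
      hKv.comp continuousOn_snd (hs S)
    have a3 : ContinuousOn (fun p : ℝ × ℝ => K p.2 ⬝ᵥ K p.2) (S ×ˢ Icc 0 L) :=
      hKK.comp continuousOn_snd (hs S)
    simp only [hq, hm, hn, hq', hm', hn']
    refine ⟨?_, ?_, ?_, ?_, ?_, ?_⟩ <;> fun_prop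
  set J : Set ℝ := Icc (-(1 / (4 * (M + 1)))) (1 / (4 * (M + 1))) with hJ
  obtain ⟨cq, cm, cn, cq', cm', cn'⟩ := hpoly J
  have cC : ContinuousOn (fun p : ℝ × ℝ => q p.1 p.2 * m p.1 p.2 - n p.1 p.2 ^ 2) (J ×ˢ Icc 0 L) :=
    (cq.mul cm).sub (cn.pow 2)
  have cC' : ContinuousOn (fun p : ℝ × ℝ => C' p.1 p.2) (J ×ˢ Icc 0 L) :=
    ((cq'.mul cm).add (cq.mul cm')).sub ((continuousOn_const.mul cn).mul cn')
  have pq : ∀ p ∈ J ×ˢ Icc 0 L, q p.1 p.2 ^ 3 ≠ 0 := fun p hp =>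
    (pow_pos (hq0 p.1 hp.1 p.2 hp.2) 3).ne'
  have cD : ContinuousOn
      (fun p : ℝ × ℝ => √((q p.1 p.2 * m p.1 p.2 - n p.1 p.2 ^ 2) / q p.1 p.2 ^ 3 + β ^ 2))
      (J ×ˢ Icc 0 L) := ((cC.div (cq.pow 3) pq).add continuousOn_const).sqrt
  refine hasDerivAt_integral_of_continuousOn_deriv hε hL.le (fun h hh => ?_) ?_
    fun h hh u hu => ?_
  · exact (cD.mul cq.sqrt).comp (f := fun u : ℝ => (h, u)) (by fun_prop) fun u hu => ⟨hh, hu⟩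
  · refine ContinuousOn.add (ContinuousOn.mul (ContinuousOn.div (ContinuousOn.div ?_ ?_ ?_)
      (continuousOn_const.mul cD) ?_) cq.sqrt) (cD.mul (cq'.div (continuousOn_const.mul cq.sqrt) ?_))
    · exact (cC'.mul (cq.pow 3)).sub (cC.mul ((continuousOn_const.mul (cq.pow 2)).mul cq'))
    · exact (cq.pow 3).pow 2
    · exact fun p hp => pow_ne_zero 2 (pq p hp)
    · intro p hp
      have h1 := hq0 p.1 hp.1 p.2 hp.2
      have h2 := hC0 p.1 p.2 hp.2
      positivity
    · intro p hp
      have h1 := hq0 p.1 hp.1 p.2 hp.2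
      positivity
  · exact hasDerivAt_sqrt_mul_sqrt hβ (hquad _ _ _ h) (hdC h u) (hq0 h hh u hu) (hC0 h u hu)

end Energy

/-! ### Horizontal lifts and conservation of the spatial momentum. -/

/-- The Lie bracket of `se(3)` in components. -/
theorem lieElt_mul_sub (v w : Fin 6 → ℝ) :
    lieElt v * lieElt w - lieElt w * lieElt v = lieElt
      ![v 4 * w 2 - v 5 * w 1 - (w 4 * v 2 - w 5 * v 1),
        v 5 * w 0 - v 3 * w 2 - (w 5 * v 0 - w 3 * v 2),
        v 3 * w 1 - v 4 * w 0 - (w 3 * v 1 - w 4 * v 0),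
        v 4 * w 5 - v 5 * w 4, v 5 * w 3 - v 3 * w 5, v 3 * w 4 - v 4 * w 3] := by
  simp only [lieElt, Matrix.fromBlocks_multiply, sub_eq_add_neg, Matrix.fromBlocks_neg,
    Matrix.fromBlocks_add]
  rw [Matrix.fromBlocks_inj]
  refine ⟨?_, ?_, by simp, by simp⟩
  · ext i j
    fin_cases i <;> fin_cases j <;> simp [rotGen] <;> ring
  · ext i j
    simp only [Matrix.add_apply, Matrix.neg_apply, Matrix.mul_apply, Fin.sum_univ_three,
      Matrix.replicateCol_apply, Matrix.mul_zero, Matrix.zero_apply]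
    fin_cases i <;> simp [rotGen] <;> ring

section Lift

open Set

variable {β L : ℝ} {γ : ℝ → SE3}

theorem IsHorizontalLift.vel_eq (h : IsHorizontalLift L γ) {s : ℝ} (hs : s ∈ Icc 0 L) :
    (fun i => vel γ (Icc 0 L) i s) =
      ![0, 0, 1, vel γ (Icc 0 L) 3 s, vel γ (Icc 0 L) 4 s, 0] := by
  obtain ⟨h0, h1, h5⟩ := h.2.1 s hs
  funext i
  fin_cases i
  · exact h0
  · exact h1
  · exact h.2.2 s hs
  · rfl
  · rfl
  · exact h5

/-- The spatial part of a horizontal lift has the third column of `R` as its tangent, and the columns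
of `R` form a rotation minimizing frame. -/
theorem IsHorizontalLift.hasDerivWithinAt (h : IsHorizontalLift L γ) (hL : 0 < L) {s : ℝ}
    (hs : s ∈ Icc 0 L) (i : Fin 3) :
    HasDerivWithinAt (fun t => (γ t).x i) ((γ s).R i 2) (Icc 0 L) s ∧
    HasDerivWithinAt (fun t => (γ t).R i 0) (-(vel γ (Icc 0 L) 4 s * (γ s).R i 2)) (Icc 0 L) s ∧
    HasDerivWithinAt (fun t => (γ t).R i 1) (vel γ (Icc 0 L) 3 s * (γ s).R i 2) (Icc 0 L) s ∧
    HasDerivWithinAt (fun t => (γ t).R i 2)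
      (vel γ (Icc 0 L) 4 s * (γ s).R i 0 - vel γ (Icc 0 L) 3 s * (γ s).R i 1) (Icc 0 L) s := by
  have h1 := h.1.hasDerivWithinAt_lieElt (by norm_num) hs (uniqueDiffOn_Icc hL s hs)
  rw [h.vel_eq hs] at h1
  have h2 := hasDerivWithinAt_mat_iff.mp h1
  have h3 : ∀ (c : Fin 6 → ℝ) (j : Fin 3), ((γ s).toMat * lieElt c) (.inl i) (.inl j) =
      (γ s).R i 0 * rotGen (c 3) (c 4) (c 5) 0 j + (γ s).R i 1 * rotGen (c 3) (c 4) (c 5) 1 j +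
        (γ s).R i 2 * rotGen (c 3) (c 4) (c 5) 2 j := fun c j => by
    rw [toMat, lieElt, Matrix.fromBlocks_multiply, Matrix.fromBlocks_apply₁₁, Matrix.mul_zero,
      add_zero, Matrix.mul_apply, Fin.sum_univ_three]
  have h4 : ∀ c : Fin 6 → ℝ, ((γ s).toMat * lieElt c) (.inl i) (.inr 0) =
      (γ s).R i 0 * c 0 + (γ s).R i 1 * c 1 + (γ s).R i 2 * c 2 := fun c => by
    rw [toMat, lieElt, Matrix.fromBlocks_multiply, Matrix.fromBlocks_apply₁₂, Matrix.mul_zero,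
      add_zero, Matrix.mul_apply, Fin.sum_univ_three]
    rfl
  refine ⟨(h2 (.inl i) (.inr 0)).congr_deriv ?_, (h2 (.inl i) (.inl 0)).congr_deriv ?_,
    (h2 (.inl i) (.inl 1)).congr_deriv ?_, (h2 (.inl i) (.inl 2)).congr_deriv ?_⟩
  · simp [h4]
  · simp [h3, rotGen, mul_comm]
  · simp [h3, rotGen, mul_comm]
  · simp only [h3]
    simp [rotGen]
    ring

theorem sum_R_mul_R (g : SE3) (i j : Fin 3) :
    g.R 0 i * g.R 0 j + g.R 1 i * g.R 1 j + g.R 2 i * g.R 2 j = if i = j then 1 else 0 := by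
  have h := congrFun (congrFun g.orth i) j
  rwa [Matrix.mul_apply, Fin.sum_univ_three, Matrix.one_apply] at h

/-- A vector with vanishing scalar product with the frame is zero. -/
theorem eq_zero_of_R_combination {g : SE3} {a b c : ℝ}
    (h : ∀ i, a * g.R i 0 + b * g.R i 1 + c * g.R i 2 = 0) : a = 0 ∧ b = 0 ∧ c = 0 := by
  have h1 : g.R *ᵥ ![a, b, c] = 0 := by
    funext i
    rw [Matrix.mulVec, dotProduct, Fin.sum_univ_three]
    change g.R i 0 * a + g.R i 1 * b + g.R i 2 * c = 0
    linarith [h i]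
  have h2 : ![a, b, c] = 0 := by
    rw [← Matrix.one_mulVec ![a, b, c], ← g.orth, ← Matrix.mulVec_mulVec, h1, Matrix.mulVec_zero]
  exact ⟨congrFun h2 0, congrFun h2 1, congrFun h2 2⟩

/-- The Euler-Lagrange equations of the energy in the rotation minimizing frame: the momentum is
constant in space. -/
theorem IsStationaryCurve.euler_lagrange (hβ : 0 < β) (hL : 0 < L) (hγ : IsHorizontalLift L γ)
    (hx : IsStationaryCurve β L fun s => (γ s).x) {w₁' w₂' w₁'' w₂'' p p' : ℝ → ℝ}
    (h₁ : ∀ s ∈ Icc 0 L, HasDerivWithinAt (w₁ β L γ) (w₁' s) (Icc 0 L) s)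
    (h₂ : ∀ s ∈ Icc 0 L, HasDerivWithinAt (w₂ β L γ) (w₂' s) (Icc 0 L) s)
    (h₁' : ∀ s ∈ Icc 0 L, HasDerivWithinAt w₁' (w₁'' s) (Icc 0 L) s)
    (h₂' : ∀ s ∈ Icc 0 L, HasDerivWithinAt w₂' (w₂'' s) (Icc 0 L) s)
    (hw₁ : ContinuousOn w₁'' (Icc 0 L)) (hw₂ : ContinuousOn w₂'' (Icc 0 L))
    (hp : ∀ s, p s = β ^ 2 / √(vel γ (Icc 0 L) 4 s ^ 2 + vel γ (Icc 0 L) 3 s ^ 2 + β ^ 2))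
    (hp' : ∀ s ∈ Icc 0 L, HasDerivWithinAt p (p' s) (Icc 0 L) s)
    (hpc : ContinuousOn p' (Icc 0 L)) :
    ∀ s ∈ Icc 0 L, w₁'' s = p s * vel γ (Icc 0 L) 4 s ∧ w₂'' s = -(p s * vel γ (Icc 0 L) 3 s) ∧
      p' s = w₂' s * vel γ (Icc 0 L) 3 s - w₁' s * vel γ (Icc 0 L) 4 s := by
  have hU := uniqueDiffOn_Icc hL
  set a := vel γ (Icc 0 L) 3 with ha
  set b := vel γ (Icc 0 L) 4 with hb
  have hac : ContinuousOn a (Icc 0 L) :=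
    (hγ.1.contDiffOn_vel (m := 2) hU (by norm_num) 3).continuousOn
  have hbc : ContinuousOn b (Icc 0 L) :=
    (hγ.1.contDiffOn_vel (m := 2) hU (by norm_num) 4).continuousOn
  have hRc : ∀ i j, ContinuousOn (fun s => (γ s).R i j) (Icc 0 L) :=
    fun i j => (hγ.1 (.inl i) (.inl j)).continuousOn
  have hw₁c : ContinuousOn w₁' (Icc 0 L) := fun s hs => (h₁' s hs).continuousWithinAt
  have hw₂c : ContinuousOn w₂' (Icc 0 L) := fun s hs => (h₂' s hs).continuousWithinAt
  have hpc0 : ContinuousOn p (Icc 0 L) := fun s hs => (hp' s hs).continuousWithinAt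
  have hwc₁ : ContinuousOn (w₁ β L γ) (Icc 0 L) := fun s hs => (h₁ s hs).continuousWithinAt
  have hwc₂ : ContinuousOn (w₂ β L γ) (Icc 0 L) := fun s hs => (h₂ s hs).continuousWithinAt
  -- the spatial momentum `P` and its derivative `P'`
  set P : Fin 3 → ℝ → ℝ := fun i s =>
    -(w₁' s * (γ s).R i 0) - w₂' s * (γ s).R i 1 + p s * (γ s).R i 2 with hP
  set P' : Fin 3 → ℝ → ℝ := fun i s =>
    (p s * b s - w₁'' s) * (γ s).R i 0 + (-(p s * a s) - w₂'' s) * (γ s).R i 1 +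
      (p' s + w₁' s * b s - w₂' s * a s) * (γ s).R i 2 with hP'
  have hPd : ∀ i, ∀ s ∈ Icc 0 L, HasDerivWithinAt (P i) (P' i s) (Icc 0 L) s := by
    intro i s hs
    obtain ⟨-, d0, d1, d2⟩ := hγ.hasDerivWithinAt hL hs i
    refine ((((h₁' s hs).mul d0).neg.sub ((h₂' s hs).mul d1)).add ((hp' s hs).mul d2)).congr_deriv ?_
    simp only [hP']
    ring
  have hP'c : ∀ i, ContinuousOn (P' i) (Icc 0 L) := by
    intro i
    have := hRc i 0
    have := hRc i 1
    have := hRc i 2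
    simp only [hP']
    fun_prop
  -- The columns of `R` are independent, so `P' = 0` splits into the three scalar equations.
  suffices H : ∀ i, ∀ s ∈ Icc 0 L, P' i s = 0 by
    intro s hs
    obtain ⟨e1, e2, e3⟩ := eq_zero_of_R_combination fun i => H i s hs
    exact ⟨by linarith, by linarith, by linarith⟩
  intro i
  refine eqOn_zero_of_integral_contDiff_mul_eq_zero hL (hP'c i) fun φ hφ hsupp => ?_
  have hφ0 := eq_zero_left_of_tsupport_subset_Ioo hsupp
  have hφ1 := eq_zero_right_of_tsupport_subset_Ioo hsupp
  -- `φ'` must vanish at the ends too: the term in `φ''` is integrated by parts against `φ'`.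
  have hsupp' : tsupport (deriv φ) ⊆ Ioo 0 L := (tsupport_deriv_subset (𝕜 := ℝ)).trans hsupp
  have hφ' : ContDiff ℝ ∞ (deriv φ) := (contDiff_infty_iff_deriv.mp hφ).2
  have dφ : ∀ s, HasDerivAt φ (deriv φ s) s := fun s =>
    (hφ.differentiable (by simp) s).hasDerivAt
  have dφ' : ∀ s, HasDerivAt (deriv φ) (deriv (deriv φ) s) s := fun s =>
    (hφ'.differentiable (by simp) s).hasDerivAt
  have hφ'' : Continuous (deriv (deriv φ)) := hφ'.continuous_deriv (by simp)
  set T : ℝ → Fin 3 → ℝ := fun s j => (γ s).R j 2 with hT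
  set K : ℝ → Fin 3 → ℝ := fun s j => b s * (γ s).R j 0 - a s * (γ s).R j 1 with hK
  have hTT : ∀ s, T s ⬝ᵥ T s = 1 := fun s => by
    rw [dotProduct, Fin.sum_univ_three]
    exact sum_R_mul_R (γ s) 2 2
  have hTK : ∀ s, T s ⬝ᵥ K s = 0 := fun s => by
    have e0 := sum_R_mul_R (γ s) 2 0
    have e1 := sum_R_mul_R (γ s) 2 1
    rw [if_neg (by decide)] at e0 e1
    simp only [dotProduct, Fin.sum_univ_three, hT, hK]
    linear_combination b s * e0 - a s * e1
  have hKK : ∀ s, K s ⬝ᵥ K s = b s ^ 2 + a s ^ 2 := fun s => by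
    have e0 := sum_R_mul_R (γ s) 0 0
    have e1 := sum_R_mul_R (γ s) 0 1
    have e2 := sum_R_mul_R (γ s) 1 1
    rw [if_neg (by decide)] at e1
    rw [if_pos rfl] at e0 e2
    simp only [dotProduct, Fin.sum_univ_three, hK]
    linear_combination b s ^ 2 * e0 - 2 * a s * b s * e1 + a s ^ 2 * e2
  have hKc : ContinuousOn K (Icc 0 L) := continuousOn_pi.mpr fun j =>
    (hbc.mul (hRc j 0)).sub (hac.mul (hRc j 1))
  have hvar := hasDerivAt_energy hβ hL (x := fun s => (γ s).x) (T := T) (K := K)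
    (fun s hs => hasDerivWithinAt_pi.mpr fun j => (hγ.hasDerivWithinAt hL hs j).1)
    (fun s hs => hasDerivWithinAt_pi.mpr fun j => (hγ.hasDerivWithinAt hL hs j).2.2.2)
    hKc (fun s _ => hTT s) (fun s _ => hTK s) dφ dφ' hφ'' (Pi.single i 1)
  have hstat := hx.2.2 (fun s => φ s • Pi.single i 1) (hφ.smul contDiff_const)
    ((tsupport_smul_subset_left φ _).trans hsupp)
  have h0 := hvar.unique hstat
  simp only [dotProduct_single, mul_one] at h0
  -- The `i`-th component of `K / √(κ² + β²)`, the coefficient of `φ''` in the first variation.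
  set W : ℝ → ℝ := fun s => w₁ β L γ s * (γ s).R i 0 + w₂ β L γ s * (γ s).R i 1 with hW
  set W' : ℝ → ℝ := fun s => w₁' s * (γ s).R i 0 + w₂' s * (γ s).R i 1 -
    (w₁ β L γ s * b s - w₂ β L γ s * a s) * (γ s).R i 2 with hW'
  have hWd : ∀ s ∈ Icc 0 L, HasDerivWithinAt W (W' s) (Icc 0 L) s := by
    intro s hs
    obtain ⟨-, d0, d1, -⟩ := hγ.hasDerivWithinAt hL hs i
    refine (((h₁ s hs).mul d0).add ((h₂ s hs).mul d1)).congr_deriv ?_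
    simp only [hW']
    ring
  have hR0 := hRc i 0
  have hR1 := hRc i 1
  have hR2 := hRc i 2
  have hWc : ContinuousOn W (Icc 0 L) := by
    simp only [hW]
    fun_prop
  have hW'c : ContinuousOn W' (Icc 0 L) := by
    simp only [hW']
    fun_prop
  have hPc : ContinuousOn (P i) (Icc 0 L) := fun s hs => (hPd i s hs).continuousWithinAt
  -- In `P + W'` the normal components cancel, and the tangential one is `p - (w₁ b - w₂ a) = (β² -
  -- κ²)/√(κ² + β²)`. After integration by parts `∫ W φ''` cancels `∫ φ' W'`, leaving `-∫ φ P' = 0`.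
  have hint : ∀ s, deriv (deriv φ) s * (K s i / √(K s ⬝ᵥ K s + β ^ 2)) +
      deriv φ s * (T s i * ((β ^ 2 - K s ⬝ᵥ K s) / √(K s ⬝ᵥ K s + β ^ 2))) =
      W s * deriv (deriv φ) s + (P i s * deriv φ s + deriv φ s * W' s) := by
    intro s
    have hD : 0 < √(b s ^ 2 + a s ^ 2 + β ^ 2) := Real.sqrt_pos.mpr (by positivity)
    rw [hKK]
    simp only [hW, hW', hP, hp, hK, hT, w₁, w₂, ← ha, ← hb]
    field_simp
    ring
  simp only [hint] at h0
  have hicc : ∀ {f : ℝ → ℝ}, ContinuousOn f (Icc 0 L) →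
      IntervalIntegrable f MeasureTheory.volume 0 L := fun hf =>
    ContinuousOn.intervalIntegrable (by rwa [uIcc_of_le hL.le])
  have c1 : ContinuousOn (fun s => W s * deriv (deriv φ) s) (Icc 0 L) := hWc.mul hφ''.continuousOn
  have c2 : ContinuousOn (fun s => P i s * deriv φ s) (Icc 0 L) :=
    hPc.mul hφ'.continuous.continuousOn
  have c3 : ContinuousOn (fun s => deriv φ s * W' s) (Icc 0 L) :=
    hφ'.continuous.continuousOn.mul hW'c
  have c4 : ContinuousOn (fun s => P i s * deriv φ s + deriv φ s * W' s) (Icc 0 L) := c2.add c3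
  rw [intervalIntegral.integral_add (hicc c1) (hicc c4),
    intervalIntegral.integral_add (hicc c2) (hicc c3),
    integral_mul_deriv_of_eq_zero hL.le hWd hW'c dφ' hφ''
      (eq_zero_left_of_tsupport_subset_Ioo hsupp') (eq_zero_right_of_tsupport_subset_Ioo hsupp'),
    integral_mul_deriv_of_eq_zero hL.le (hPd i) (hP'c i) dφ hφ'.continuous hφ0 hφ1] at h0
  linarith

/-- Since `1 - ‖w‖² = β²/(κ² + β²)`, the third component is a smooth function of the curvatures and
can be differentiated. -/
theorem momentum_three (hβ : 0 < β) (s : ℝ) :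
    β * √(1 - (w₁ β L γ s ^ 2 + w₂ β L γ s ^ 2)) =
      β ^ 2 / √(vel γ (Icc 0 L) 4 s ^ 2 + vel γ (Icc 0 L) 3 s ^ 2 + β ^ 2) := by
  set a := vel γ (Icc 0 L) 3 s with ha
  set b := vel γ (Icc 0 L) 4 s with hb
  have hD : 0 < √(b ^ 2 + a ^ 2 + β ^ 2) := Real.sqrt_pos.mpr (by positivity)
  have hD2 : √(b ^ 2 + a ^ 2 + β ^ 2) ^ 2 = b ^ 2 + a ^ 2 + β ^ 2 := Real.sq_sqrt (by positivity)
  have h : 1 - (w₁ β L γ s ^ 2 + w₂ β L γ s ^ 2) = (β / √(b ^ 2 + a ^ 2 + β ^ 2)) ^ 2 := by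
    simp only [w₁, w₂, ← ha, ← hb, div_pow, hD2]
    have : b ^ 2 + a ^ 2 + β ^ 2 ≠ 0 := by positivity
    field_simp
    ring
  rw [h, Real.sqrt_sq (by positivity)]
  ring

/-- The momentum is covariantly constant along horizontal lifts of stationary curves of the energy. -/
theorem IsHorizontalLift.cartanBarDual_momentum_eq_zero (hβ : 0 < β) (hL : 0 < L)
    (hγ : IsHorizontalLift L γ) (hx : IsStationaryCurve β L fun s => (γ s).x) {s : ℝ}
    (hs : s ∈ Icc 0 L) :
    cartanBarDual γ (Icc 0 L) (covector γ (momentum β L γ)) s = 0 := by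
  have hU := uniqueDiffOn_Icc hL
  have ha : ContDiffOn ℝ 2 (vel γ (Icc 0 L) 3) (Icc 0 L) := hγ.1.contDiffOn_vel hU (by norm_num) 3
  have hb : ContDiffOn ℝ 2 (vel γ (Icc 0 L) 4) (Icc 0 L) := hγ.1.contDiffOn_vel hU (by norm_num) 4
  have hpos : ∀ s, 0 < vel γ (Icc 0 L) 4 s ^ 2 + vel γ (Icc 0 L) 3 s ^ 2 + β ^ 2 := fun s => by
    positivity
  have hDne : ∀ s, √(vel γ (Icc 0 L) 4 s ^ 2 + vel γ (Icc 0 L) 3 s ^ 2 + β ^ 2) ≠ 0 := fun s =>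
    (Real.sqrt_pos.mpr (hpos s)).ne'
  have hD : ContDiffOn ℝ 2
      (fun s => √(vel γ (Icc 0 L) 4 s ^ 2 + vel γ (Icc 0 L) 3 s ^ 2 + β ^ 2)) (Icc 0 L) :=
    (((hb.pow 2).add (ha.pow 2)).add contDiffOn_const).sqrt fun s _ => (hpos s).ne'
  have hw₁ : ContDiffOn ℝ 2 (w₁ β L γ) (Icc 0 L) := hb.div hD fun s _ => hDne s
  have hw₂ : ContDiffOn ℝ 2 (w₂ β L γ) (Icc 0 L) := ha.neg.div hD fun s _ => hDne s
  set p : ℝ → ℝ := fun s =>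
    β ^ 2 / √(vel γ (Icc 0 L) 4 s ^ 2 + vel γ (Icc 0 L) 3 s ^ 2 + β ^ 2) with hp
  have hpd : ContDiffOn ℝ 2 p (Icc 0 L) := contDiffOn_const.div hD fun s _ => hDne s
  have hw₁' : ContDiffOn ℝ 1 (derivWithin (w₁ β L γ) (Icc 0 L)) (Icc 0 L) :=
    hw₁.derivWithin hU (by norm_num)
  have hw₂' : ContDiffOn ℝ 1 (derivWithin (w₂ β L γ) (Icc 0 L)) (Icc 0 L) :=
    hw₂.derivWithin hU (by norm_num)
  have hd : ∀ {n : WithTop ℕ∞} {f : ℝ → ℝ}, ContDiffOn ℝ n f (Icc 0 L) → n ≠ 0 → ∀ s ∈ Icc 0 L,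
      HasDerivWithinAt f (derivWithin f (Icc 0 L) s) (Icc 0 L) s := fun hf hn s hs =>
    (hf.differentiableOn hn s hs).hasDerivWithinAt
  obtain ⟨e1, e2, e3⟩ := hx.euler_lagrange hβ hL hγ (hd hw₁ two_ne_zero) (hd hw₂ two_ne_zero)
    (hd hw₁' one_ne_zero) (hd hw₂' one_ne_zero) (hw₁'.continuousOn_derivWithin hU le_rfl)
    (hw₂'.continuousOn_derivWithin hU le_rfl) (p := p) (fun _ => rfl) (hd hpd two_ne_zero)
    (hpd.continuousOn_derivWithin hU (by norm_num)) s hs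
  have hm : ∀ t, momentum β L γ t = ![-derivWithin (w₁ β L γ) (Icc 0 L) t,
      -derivWithin (w₂ β L γ) (Icc 0 L) t, p t, -w₂ β L γ t, w₁ β L γ t, 0] := fun t => by
    rw [momentum, momentum_three hβ]
  refine cartanBarDual_covector_eq_zero (hγ.2.1 s hs) fun j => ?_
  rw [hγ.vel_eq hs]
  simp only [hm, A, lieElt_mul_sub, coord_lieElt, Fin.sum_univ_six]
  have hneg : ∀ f : ℝ → ℝ, derivWithin (fun t => -f t) (Icc 0 L) s =
      -derivWithin f (Icc 0 L) s := fun f => derivWithin.fun_neg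
  -- The sixth equation: `(w₁, w₂)` is a multiple of `(κ₁, κ₂)`.
  have e6 : vel γ (Icc 0 L) 4 s * w₂ β L γ s + vel γ (Icc 0 L) 3 s * w₁ β L γ s = 0 := by
    simp only [w₁, w₂]
    ring
  fin_cases j
  · simp [hneg, e1]
  · simp [hneg, e2]
  · simp [e3]
    ring
  · simp [hneg]
  · simp
  · simp
    linarith

end Lift

end SE3

theorem mainTheorem6 :
    -- exponential curves and autoparallel curves, on any interval `I` containing `0`
    (∀ I : Set ℝ, I.OrdConnected → I.Nontrivial → 0 ∈ I → ∀ γ : ℝ → SE3,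
      -- autoparallel curves of the Cartan connection
      (SE3.IsAutoparallel γ I ↔ ∃ c, SE3.IsExpCurve γ I c) ∧
      (SE3.IsAutoparallel γ I ∧ SE3.IsSpatialArcLength γ I ↔
        ∃ c, c 0 ^ 2 + c 1 ^ 2 + c 2 ^ 2 = 1 ∧ SE3.IsExpCurve γ I c) ∧
      (SE3.IsAutoparallel γ I ∧ SE3.IsSpatialArcLength γ I ∧ (∀ s ∈ I, SE3.vel γ I 5 s = 0) ↔
        ∃ c, c 5 = 0 ∧ c 0 ^ 2 + c 1 ^ 2 + c 2 ^ 2 = 1 ∧ SE3.IsExpCurve γ I c) ∧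
      -- autoparallel curves of the connection on the horizontal distribution
      (SE3.IsBarAutoparallel γ I ↔ SE3.IsHorizontal γ I ∧ ∃ c, SE3.IsExpCurve γ I c) ∧
      (SE3.IsBarAutoparallel γ I ↔
        ∃ c, (c 0 = 0 ∧ c 1 = 0 ∧ c 5 = 0) ∧ SE3.IsExpCurve γ I c) ∧
      (SE3.IsBarAutoparallel γ I ∧ SE3.IsSpatialArcLength γ I ↔
        ∃ c, (c 0 = 0 ∧ c 1 = 0 ∧ c 5 = 0) ∧ c 2 ^ 2 = 1 ∧ SE3.IsExpCurve γ I c)) ∧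
    -- the momentum is covariantly constant along stationary curves
    (∀ β : ℝ, 0 < β →
      -- stationary curves in the extended manifold, with their Lagrange multipliers as momentum
      (∀ ℓ : ℝ, 0 < ℓ → ∀ Γ : ℝ → SE3.ExtPoint, SE3.IsStationaryExt β ℓ Γ →
        SE3.IsHorizontal (fun r => (Γ r).g) (Set.Icc 0 ℓ) ∧
        ∀ r ∈ Set.Icc 0 ℓ, SE3.cartanBarDual (fun r => (Γ r).g) (Set.Icc 0 ℓ)
          (SE3.covector (fun r => (Γ r).g) fun r => (Γ r).lam) r = 0) ∧
      -- horizontal lifts of the stationary curves of the energy in three-dimensional space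
      (∀ L : ℝ, 0 < L → ∀ γ : ℝ → SE3, SE3.IsHorizontalLift L γ →
        SE3.IsStationaryCurve β L (fun s => (γ s).x) →
        ∀ s ∈ Set.Icc 0 L, SE3.cartanBarDual γ (Set.Icc 0 L)
          (SE3.covector γ (SE3.momentum β L γ)) s = 0)) := by
  exact ⟨fun I hI hn h0 γ => SE3.autoparallel_characterization hI hn h0 γ,
    fun β hβ => ⟨fun ℓ hℓ Γ hΓ => hΓ.isHorizontal_and_cartanBarDual_eq_zero hℓ,
      fun L hL γ hγ hx s hs => hγ.cartanBarDual_momentum_eq_zero hβ hL hx hs⟩⟩
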